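/- Let $m,n\ge 0$ be integers, let $\varphi:\mathbb R^m\times\mathbb R^n\to\mathbb R$, $(t,x)\mapsto\varphi(t,x)$, be a (finite-valued) function that is convex jointly in $(t,x)$, and let $\psi:\mathbb R^n\to\mathbb R$ be a (finite-valued) convex function. Assume that $$\int_{\mathbb R^n} e^{\psi(x)-\varphi(0,x)}\,dx=1,$$ where $dx$ is Lebesgue measure. Then there is a (finite-valued) function $\Psi:\mathbb R^m\times\mathbb R^n\to\mathbb R$, convex jointly in $(t,x)$, such that $\Psi(0,x)=\psi(x)$ for all $x\in\mathbb R^n$ and $$\int_{\mathbb R^n} e^{\Psi(t,x)-\varphi(t,x)}\,dx\le 1\qquad\text{for every } t\in\mathbb R^m.$$ -/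

import Mathlib

open MeasureTheory

open Filter Topology

/-! Approximate ψ from below by functions θ log ∑ᵢ exp(ℓᵢ x + cᵢ) with 0 < θ ≤ 1, and extend each
one as θ log ∑ᵢ exp(ℓᵢ x + cᵢ + αᵢ·t), which is jointly convex for every choice of slopes αᵢ. Its
mass M(t) against exp(-φ(t,·)) splits into shares Gᵢ(t), one per exponential. Since θ ≤ 1, the
integrand of each share is jointly log-concave, so Prékopa's theorem makes each Gᵢ log-concave in t.

The slopes minimise ∑ M(t)^(p+1) over a finite set T of times. Stationarity in αᵢ says that the
points t, weighted by M(t)^p Gᵢ(t), have barycentre 0; Jensen then gives ∑ M^p Gᵢ log(Gᵢ(t)/Gᵢ(0)) ≤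
0. Summing over i, with log y ≤ y - 1 and M(0) ≤ 1, yields ∑ M^(p+1) log M ≤ 0, hence ∑ M^(p+1) ≤
|T|. For large p this forces M ≤ 1 + ε on T (`exists_shiftMass_le`).

Finally let T exhaust a dense set while ε → 0. The extensions are pointwise bounded, compactness
produces a convex limit, and Fatou's lemma keeps the mass bound
(`exists_convexOn_extension_of_approx`). -/

/-! ### The Prékopa–Leindler inequality on the line -/

/-- One-dimensional **Brunn–Minkowski inequality** for open sets. -/
theorem Real.volume_add_volume_le_of_isOpen {A B C : Set ℝ} (hA : IsOpen A) (hB : IsOpen B)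
    (hA' : A.Nonempty) (hB' : B.Nonempty) (hC : ∀ a ∈ A, ∀ b ∈ B, a + b ∈ C) :
    volume A + volume B ≤ volume C := by
  have key : ∀ K ⊆ A, ∀ L ⊆ B, IsCompact K → IsCompact L → K.Nonempty → L.Nonempty →
      volume K + volume L ≤ volume C := by
    intro K hKA L hLB hK hL hKn hLn
    obtain ⟨a, haK, ha⟩ := hK.exists_isGreatest hKn
    obtain ⟨b, hbL, hb⟩ := hL.exists_isLeast hLn
    -- With a = max K and b = min L, the translates K + b and a + L lie in C and meet at most in the
    -- point a + b.
    have h1 : volume ((fun x => x + b) '' K) = volume K := by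
      simp [Set.image_add_right, measure_preimage_add_right]
    have h2 : volume ((fun x => a + x) '' L) = volume L := by
      simp [Set.image_add_left, measure_preimage_add]
    rw [← h1, ← h2, ← measure_union₀' (hK.image (by fun_prop)).measurableSet.nullMeasurableSet]
    · refine measure_mono (Set.union_subset ?_ ?_)
      · rintro _ ⟨x, hx, rfl⟩
        exact hC _ (hKA hx) _ (hLB hbL)
      · rintro _ ⟨x, hx, rfl⟩
        exact hC _ (hKA haK) _ (hLB hx)
    · refine measure_mono_null (t := {a + b}) ?_ (by simp)
      rintro _ ⟨⟨x, hx, rfl⟩, ⟨y, hy, hxy⟩⟩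
      have := ha hx
      have := hb hy
      simp only [Set.mem_singleton_iff] at *
      linarith
  have hA0 := (hA.measure_pos volume hA').ne'
  have hB0 := (hB.measure_pos volume hB').ne'
  by_contra! hlt
  obtain ⟨r, hr, s, hs, hrs⟩ := ENNReal.exists_lt_add_of_lt_add hlt hA0 hB0
  obtain ⟨K, hKA, hK, hrK⟩ := hA.exists_lt_isCompact hr
  obtain ⟨L, hLB, hL, hsL⟩ := hB.exists_lt_isCompact hs
  exact hrs.not_ge ((add_le_add hrK.le hsL.le).trans (key K hKA L hLB hK hL
    (nonempty_of_measure_ne_zero (bot_le.trans_lt hrK).ne')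
    (nonempty_of_measure_ne_zero (bot_le.trans_lt hsL).ne')))

/-- The one-dimensional **Prékopa–Leindler inequality**, arithmetic form for normalised
functions. -/
theorem Real.lintegral_exp_neg_add_le {u v w : ℝ → ℝ} (hu : Continuous u) (hv : Continuous v)
    (hw : Continuous w) (hu0 : ∀ x, 0 ≤ u x) (hv0 : ∀ x, 0 ≤ v x)
    (hu1 : ∀ ε > 0, ∃ x, u x < ε) (hv1 : ∀ ε > 0, ∃ x, v x < ε) {a b : ℝ} (ha : 0 < a)
    (hb : 0 < b) (hab : a + b = 1) (h : ∀ x y, w (a * x + b * y) ≤ a * u x + b * v y) :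
    ENNReal.ofReal a * (∫⁻ x, ENNReal.ofReal (Real.exp (-u x))) +
      ENNReal.ofReal b * (∫⁻ x, ENNReal.ofReal (Real.exp (-v x))) ≤
      ∫⁻ x, ENNReal.ofReal (Real.exp (-w x)) := by
  have cake : ∀ f : ℝ → ℝ, Continuous f → ∫⁻ x, ENNReal.ofReal (Real.exp (-f x)) =
      ∫⁻ r in Set.Ioi 0, volume {x | r < Real.exp (-f x)} := fun f hf =>
    lintegral_eq_lintegral_meas_lt volume (Filter.Eventually.of_forall fun x => (Real.exp_pos _).le)
      (by fun_prop)
  have meas : ∀ f : ℝ → ℝ, Measurable fun r : ℝ => volume {x | r < Real.exp (-f x)} := fun f =>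
    Antitone.measurable fun r s hrs => measure_mono fun x hx => lt_of_le_of_lt hrs hx
  rw [cake u hu, cake v hv, cake w hw, ← lintegral_const_mul _ (meas u),
    ← lintegral_const_mul _ (meas v), ← lintegral_add_left ((meas u).const_mul _)]
  refine lintegral_mono_ae ((ae_restrict_iff' measurableSet_Ioi).2 (Filter.Eventually.of_forall
    fun r (hr : 0 < r) => ?_))
  -- Brunn–Minkowski needs nonempty superlevel sets. Normalising u and v to infimum 0 makes both
  -- empty for r ≥ 1 and both nonempty for r < 1.
  rcases le_or_gt 1 r with h1 | h1
  · have : ∀ f : ℝ → ℝ, (∀ x, 0 ≤ f x) → {x | r < Real.exp (-f x)} = ∅ := fun f hf => by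
      ext x
      simpa using (Real.exp_le_one_iff.2 (neg_nonpos.2 (hf x))).trans h1
    simp [this u hu0, this v hv0]
  have hlog : 0 < -Real.log r := neg_pos.2 (Real.log_neg hr h1)
  have hlt : ∀ z : ℝ, r < Real.exp (-z) ↔ z < -Real.log r := fun z => by
    rw [← Real.log_lt_iff_lt_exp hr]; constructor <;> intro <;> linarith
  have scale : ∀ (c : ℝ), 0 < c → ∀ s : Set ℝ,
      ENNReal.ofReal c * volume s = volume ((fun x => c⁻¹ * x) ⁻¹' s) := fun c hc s => by
    rw [Real.volume_preimage_mul_left (inv_pos.2 hc).ne', inv_inv, abs_of_pos hc]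
  simp only [hlt]
  rw [scale a ha, scale b hb]
  have ne : ∀ (c : ℝ), 0 < c → ∀ f : ℝ → ℝ, (∀ ε > 0, ∃ x, f x < ε) →
      ((fun x => c⁻¹ * x) ⁻¹' {x | f x < -Real.log r}).Nonempty := fun c hc f hf => by
    obtain ⟨x, hx⟩ := hf _ hlog
    exact ⟨c * x, by simpa [hc.ne'] using hx⟩
  refine Real.volume_add_volume_le_of_isOpen
    ((isOpen_lt hu continuous_const).preimage (by fun_prop))
    ((isOpen_lt hv continuous_const).preimage (by fun_prop)) (ne a ha u hu1) (ne b hb v hv1) ?_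
  intro x hx y hy
  simp only [Set.mem_preimage, Set.mem_ofPred_eq] at hx hy ⊢
  have := h (a⁻¹ * x) (b⁻¹ * y)
  rw [mul_inv_cancel_left₀ ha.ne', mul_inv_cancel_left₀ hb.ne'] at this
  nlinarith

/-- Young's inequality with the conjugate exponents 1/a and 1/b. -/
theorem ENNReal.rpow_mul_rpow_le_add (X Y : ENNReal) {a b : ℝ} (ha : 0 < a) (hb : 0 < b)
    (hab : a + b = 1) : X ^ a * Y ^ b ≤ ENNReal.ofReal a * X + ENNReal.ofReal b * Y := by
  have hpq : (a⁻¹).HolderConjugate b⁻¹ := by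
    rw [Real.holderConjugate_iff]
    exact ⟨(one_lt_inv₀ ha).2 (by linarith), by simpa using hab⟩
  have := ENNReal.young_inequality (X ^ a) (Y ^ b) hpq
  rwa [← ENNReal.rpow_mul, ← ENNReal.rpow_mul, mul_inv_cancel₀ ha.ne', mul_inv_cancel₀ hb.ne',
    ENNReal.rpow_one, ENNReal.rpow_one, div_eq_mul_inv, div_eq_mul_inv,
    ← ENNReal.ofReal_inv_of_pos (inv_pos.2 ha), ← ENNReal.ofReal_inv_of_pos (inv_pos.2 hb),
    inv_inv, inv_inv, mul_comm X, mul_comm Y] at this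

theorem lintegral_exp_neg_sub_const (u : ℝ → ℝ) (c : ℝ) :
    ∫⁻ x, ENNReal.ofReal (Real.exp (-(u x - c))) =
      ENNReal.ofReal (Real.exp c) * ∫⁻ x, ENNReal.ofReal (Real.exp (-u x)) := by
  rw [← lintegral_const_mul' _ _ ENNReal.ofReal_ne_top]
  congr with x
  rw [← ENNReal.ofReal_mul (Real.exp_pos _).le, ← Real.exp_add]
  ring_nf

/-- The one-dimensional **Prékopa–Leindler inequality** for bounded functions. -/
theorem Real.prekopa_leindler_of_bddBelow {u v w : ℝ → ℝ} (hu : Continuous u) (hv : Continuous v)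
    (hw : Continuous w) (hu0 : BddBelow (Set.range u)) (hv0 : BddBelow (Set.range v))
    {a b : ℝ} (ha : 0 < a) (hb : 0 < b) (hab : a + b = 1)
    (h : ∀ x y, w (a * x + b * y) ≤ a * u x + b * v y) :
    (∫⁻ x, ENNReal.ofReal (Real.exp (-u x))) ^ a * (∫⁻ x, ENNReal.ofReal (Real.exp (-v x))) ^ b ≤
      ∫⁻ x, ENNReal.ofReal (Real.exp (-w x)) := by
  have inf : ∀ f : ℝ → ℝ, BddBelow (Set.range f) →
      (∀ x, 0 ≤ f x - iInf f) ∧ ∀ ε > 0, ∃ x, f x - iInf f < ε := fun f hf =>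
    ⟨fun x => sub_nonneg.2 (ciInf_le hf x), fun ε hε => by
      obtain ⟨x, hx⟩ := exists_lt_of_ciInf_lt (lt_add_of_pos_right (iInf f) hε)
      exact ⟨x, by linarith⟩⟩
  have := Real.lintegral_exp_neg_add_le (u := fun x => u x - iInf u) (v := fun x => v x - iInf v)
    (w := fun x => w x - (a * iInf u + b * iInf v)) (by fun_prop) (by fun_prop) (by fun_prop)
    (inf u hu0).1 (inf v hv0).1 (inf u hu0).2 (inf v hv0).2 ha hb hab
    (fun x y => by linarith [h x y])
  -- The infima subtracted from u, v and w contribute the same factor exp(a inf u + b inf v) to both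
  -- sides, which cancels.
  replace this := (ENNReal.rpow_mul_rpow_le_add _ _ ha hb hab).trans this
  rw [lintegral_exp_neg_sub_const, lintegral_exp_neg_sub_const, lintegral_exp_neg_sub_const,
    ENNReal.mul_rpow_of_nonneg _ _ ha.le, ENNReal.mul_rpow_of_nonneg _ _ hb.le,
    ENNReal.ofReal_rpow_of_pos (Real.exp_pos _), ENNReal.ofReal_rpow_of_pos (Real.exp_pos _),
    ← Real.exp_mul, ← Real.exp_mul, mul_mul_mul_comm, ← ENNReal.ofReal_mul (Real.exp_pos _).le,
    ← Real.exp_add, mul_comm (iInf u), mul_comm (iInf v)] at this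
  exact (ENNReal.mul_le_mul_iff_right (by simp [Real.exp_pos]) ENNReal.ofReal_ne_top).1 this

/-- The one-dimensional **Prékopa–Leindler inequality**. -/
theorem Real.prekopa_leindler {u v w : ℝ → ℝ} (hu : Continuous u) (hv : Continuous v)
    (hw : Continuous w) {a b : ℝ} (ha : 0 < a) (hb : 0 < b) (hab : a + b = 1)
    (h : ∀ x y, w (a * x + b * y) ≤ a * u x + b * v y) :
    (∫⁻ x, ENNReal.ofReal (Real.exp (-u x))) ^ a * (∫⁻ x, ENNReal.ofReal (Real.exp (-v x))) ^ b ≤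
      ∫⁻ x, ENNReal.ofReal (Real.exp (-w x)) := by
  -- Truncating u and v below at -k only increases them, so the hypothesis survives with the same w;
  -- monotone convergence removes the truncation.
  have sup : ∀ f : ℝ → ℝ, Continuous f → ∫⁻ x, ENNReal.ofReal (Real.exp (-f x)) =
      ⨆ k : ℕ, ∫⁻ x, ENNReal.ofReal (Real.exp (-max (f x) (-k))) := fun f hf => by
    rw [← lintegral_iSup (fun k => by fun_prop)]
    · congr with x
      refine le_antisymm ?_ (iSup_le fun k => ?_)
      · obtain ⟨k, hk⟩ := exists_nat_ge (-f x)
        refine le_iSup_of_le k ?_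
        rw [max_eq_left (by linarith)]
      · gcongr
        exact le_max_left _ _
    · intro k l hkl x
      dsimp only
      gcongr
  have bdd : ∀ (f : ℝ → ℝ) (k : ℕ), BddBelow (Set.range fun x => max (f x) (-k)) := fun f k =>
    ⟨-k, by rintro _ ⟨x, rfl⟩; exact le_max_right _ _⟩
  rw [sup u hu, sup v hv, ← ENNReal.orderIsoRpow_apply a ha, ← ENNReal.orderIsoRpow_apply b hb,
    OrderIso.map_iSup, OrderIso.map_iSup, ENNReal.iSup_mul]
  refine iSup_le fun k => ?_
  rw [ENNReal.mul_iSup]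
  refine iSup_le fun l => ?_
  refine Real.prekopa_leindler_of_bddBelow (by fun_prop) (by fun_prop) hw (bdd u k) (bdd v l)
    ha hb hab fun x y => (h x y).trans ?_
  gcongr <;> exact le_max_left _ _

/-! ### Log-concavity and Prékopa's theorem -/

section LogConcave

variable {E : Type*} [AddCommGroup E] [Module ℝ E]

/-- Multiplicative concavity of the logarithm of an extended nonnegative function. -/
def LogConcave (I : E → ENNReal) : Prop :=
  ∀ s t : E, ∀ a b : ℝ, 0 < a → 0 < b → a + b = 1 → I s ^ a * I t ^ b ≤ I (a • s + b • t)

/-- The point t₀ is the midpoint of t and its reflection 2t₀ - t, so an infinite value at t would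
force one at t₀. -/
theorem LogConcave.ne_top {I : E → ENNReal} (hI : LogConcave I) (hpos : ∀ t, I t ≠ 0) {t₀ : E}
    (h₀ : I t₀ ≠ ⊤) (t : E) : I t ≠ ⊤ := by
  intro ht
  have h := hI ((2 : ℝ) • t₀ - t) t (1 / 2) (1 / 2) (by norm_num) (by norm_num) (by norm_num)
  have e : (1 / 2 : ℝ) • ((2 : ℝ) • t₀ - t) + (1 / 2 : ℝ) • t = t₀ := by module
  rw [e, ht, ENNReal.top_rpow_of_pos (by norm_num), ENNReal.mul_top] at h
  · exact h₀ (top_le_iff.1 h)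
  · simp [hpos]

theorem LogConcave.convexOn {I : E → ENNReal} (hI : LogConcave I) (hpos : ∀ t, I t ≠ 0)
    (hfin : ∀ t, I t ≠ ⊤) : ConvexOn ℝ Set.univ fun t => -Real.log (I t).toReal := by
  refine convexOn_iff_forall_pos.2 ⟨convex_univ, fun s _ t _ a b ha hb hab => ?_⟩
  have h := ENNReal.toReal_mono (hfin _) (hI s t a b ha hb hab)
  have pos : ∀ t, 0 < (I t).toReal := fun t => ENNReal.toReal_pos (hpos t) (hfin t)
  rw [ENNReal.toReal_mul, ← ENNReal.toReal_rpow, ← ENNReal.toReal_rpow] at h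
  have := Real.log_le_log (mul_pos (Real.rpow_pos_of_pos (pos s) a)
    (Real.rpow_pos_of_pos (pos t) b)) h
  rw [Real.log_mul (Real.rpow_pos_of_pos (pos s) a).ne' (Real.rpow_pos_of_pos (pos t) b).ne',
    Real.log_rpow (pos s), Real.log_rpow (pos t)] at this
  simp only [smul_eq_mul]
  linarith

theorem ConvexOn.continuous_snd {F : Type*} [NormedAddCommGroup F] [NormedSpace ℝ F]
    [FiniteDimensional ℝ F] {V : E × F → ℝ} (hV : ConvexOn ℝ Set.univ V) (t : E) :
    Continuous fun x => V (t, x) := by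
  have : ConvexOn ℝ Set.univ fun x => V (t, x) := by
    refine ⟨convex_univ, fun x _ y _ a b ha hb hab => ?_⟩
    have := hV.2 (Set.mem_univ (t, x)) (Set.mem_univ (t, y)) ha hb hab
    simpa [← add_smul, hab] using this
  exact continuousOn_univ.1 (this.continuousOn isOpen_univ)

theorem lintegral_exp_ne_zero {F : Type*} [TopologicalSpace F] [MeasurableSpace F] [BorelSpace F]
    [Nonempty F] (μ : Measure F) [μ.IsOpenPosMeasure] {f : F → ℝ} (hf : Continuous f) :
    ∫⁻ x, ENNReal.ofReal (Real.exp (f x)) ∂μ ≠ 0 := by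
  refine ((lintegral_pos_iff_support (by fun_prop)).2 ?_).ne'
  have : (Function.support fun x => ENNReal.ofReal (Real.exp (f x))) = Set.univ := by
    ext x; simp [Real.exp_pos]
  rw [this]
  exact isOpen_univ.measure_pos μ Set.univ_nonempty

theorem ConvexOn.logConcave_lintegral_real {V : E × ℝ → ℝ} (hV : ConvexOn ℝ Set.univ V) :
    LogConcave fun t => ∫⁻ x, ENNReal.ofReal (Real.exp (-V (t, x))) := by
  intro s t a b ha hb hab
  refine Real.prekopa_leindler (hV.continuous_snd s) (hV.continuous_snd t) (hV.continuous_snd _)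
    ha hb hab fun x y => ?_
  simpa using hV.2 (Set.mem_univ (s, x)) (Set.mem_univ (t, y)) ha.le hb.le hab

end LogConcave

/-- **Prékopa's theorem** on `Fin n → ℝ`. -/
theorem ConvexOn.logConcave_lintegral_pi (n : ℕ) : ∀ {E : Type} [AddCommGroup E] [Module ℝ E]
    {V : E × (Fin n → ℝ) → ℝ}, ConvexOn ℝ Set.univ V →
    LogConcave fun t => ∫⁻ x, ENNReal.ofReal (Real.exp (-V (t, x))) := by
  induction n with
  | zero =>
    intro E _ _ V hV s t a b ha hb hab
    have e : ∀ t, ∫⁻ x, ENNReal.ofReal (Real.exp (-V (t, x))) =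
        ENNReal.ofReal (Real.exp (-V (t, 0))) := fun t => by
      rw [lintegral_unique, volume_pi, Measure.pi_empty_univ, mul_one]
      congr 4
      exact Prod.ext rfl (Subsingleton.elim _ _)
    simp only [e]
    rw [ENNReal.ofReal_rpow_of_pos (Real.exp_pos _), ENNReal.ofReal_rpow_of_pos (Real.exp_pos _),
      ← ENNReal.ofReal_mul (by positivity), ← Real.exp_mul, ← Real.exp_mul, ← Real.exp_add]
    gcongr
    have := hV.2 (Set.mem_univ (s, 0)) (Set.mem_univ (t, 0)) ha.le hb.le hab
    simp only [Prod.smul_mk, Prod.mk_add_mk, smul_zero, add_zero, smul_eq_mul] at this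
    linarith
  | succ n ih =>
    intro E _ _ V hV
    -- The first coordinate joins the parameter: integrate out the other n by induction, then the
    -- last real variable by the one-dimensional case. This is why the parameter space varies in the
    -- induction.
    let c : (E × ℝ) × (Fin n → ℝ) →ₗ[ℝ] E × (Fin (n + 1) → ℝ) :=
      { toFun := fun p => (p.1.1, Fin.cons p.1.2 p.2)
        map_add' := fun p q => by
          refine Prod.ext rfl (funext fun i => ?_)
          refine Fin.cases ?_ (fun j => ?_) i <;> simp
        map_smul' := fun r p => by
          refine Prod.ext rfl (funext fun i => ?_)
          refine Fin.cases ?_ (fun j => ?_) i <;> simp }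
    have hV' : ConvexOn ℝ Set.univ (V ∘ c) := by simpa using hV.comp_linearMap c
    set J : E × ℝ → ENNReal := fun q => ∫⁻ x, ENNReal.ofReal (Real.exp (-(V ∘ c) (q, x))) with hJ
    have hJc : LogConcave J := ih hV'
    have hJ0 : ∀ q, J q ≠ 0 := fun q =>
      lintegral_exp_ne_zero volume (hV'.continuous_snd q).neg
    have fubini : ∀ t, ∫⁻ x, ENNReal.ofReal (Real.exp (-V (t, x))) = ∫⁻ y, J (t, y) := by
      intro t
      have hm : Measurable fun x => ENNReal.ofReal (Real.exp (-V (t, x))) :=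
        (Real.measurable_exp.comp (hV.continuous_snd t).measurable.neg).ennreal_ofReal
      rw [← (volume_preserving_piFinSuccAbove (fun _ => ℝ) 0).symm.lintegral_comp hm,
        Measure.volume_eq_prod,
        lintegral_prod (fun p => ENNReal.ofReal (Real.exp (-V (t, _))))
          (hm.comp (MeasurableEquiv.measurable _)).aemeasurable]
      refine lintegral_congr fun y => lintegral_congr fun x => ?_
      have : (MeasurableEquiv.piFinSuccAbove (fun _ => ℝ) 0).symm (y, x) = Fin.cons y x :=
        Fin.insertNth_zero' y x
      rw [this]
      rfl
    simp only [fubini]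
    -- One finite value of J makes J finite everywhere, so -log J is a real convex function;
    -- otherwise J is identically infinite and the inequality is trivial.
    by_cases hfin : ∃ q, J q ≠ ⊤
    · obtain ⟨q₀, hq₀⟩ := hfin
      have hJt := hJc.ne_top hJ0 hq₀
      have := (hJc.convexOn hJ0 hJt).logConcave_lintegral_real
      have e : ∀ q, ENNReal.ofReal (Real.exp (- -Real.log (J q).toReal)) = J q := fun q => by
        rw [neg_neg, Real.exp_log (ENNReal.toReal_pos (hJ0 q) (hJt q)),
          ENNReal.ofReal_toReal (hJt q)]
      simpa only [e] using this
    · push Not at hfin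
      intro s t a b ha hb hab
      simp [hfin]

/-- **Prékopa's theorem**. -/
theorem ConvexOn.logConcave_lintegral {n : ℕ} {E : Type} [AddCommGroup E] [Module ℝ E]
    {V : E × EuclideanSpace ℝ (Fin n) → ℝ} (hV : ConvexOn ℝ Set.univ V) :
    LogConcave fun t => ∫⁻ x, ENNReal.ofReal (Real.exp (-V (t, x))) := by
  let c : E × (Fin n → ℝ) →ₗ[ℝ] E × EuclideanSpace ℝ (Fin n) :=
    LinearMap.prodMap LinearMap.id (WithLp.linearEquiv 2 ℝ (Fin n → ℝ)).symm.toLinearMap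
  have hV' : ConvexOn ℝ Set.univ (V ∘ c) := by simpa using hV.comp_linearMap c
  have := ConvexOn.logConcave_lintegral_pi n hV'
  have e : ∀ t, ∫⁻ x, ENNReal.ofReal (Real.exp (-V (t, x))) =
      ∫⁻ x, ENNReal.ofReal (Real.exp (-(V ∘ c) (t, x))) := fun t => by
    have hm : Measurable fun x => ENNReal.ofReal (Real.exp (-V (t, x))) :=
      (Real.measurable_exp.comp (hV.continuous_snd t).measurable.neg).ennreal_ofReal
    rw [← (PiLp.volume_preserving_toLp (Fin n)).lintegral_comp hm]
    rfl
  simpa only [e] using this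

/-! ### Prékopa's theorem for real-valued integrals -/

theorem integrable_exp_iff {F : Type*} [TopologicalSpace F] [MeasurableSpace F] [BorelSpace F]
    [SecondCountableTopology F] {μ : Measure F} {f : F → ℝ} (hf : Continuous f) :
    Integrable (fun x => Real.exp (f x)) μ ↔ ∫⁻ x, ENNReal.ofReal (Real.exp (f x)) ∂μ ≠ ⊤ := by
  rw [← lt_top_iff_ne_top, ← hasFiniteIntegral_iff_ofReal
    (Filter.Eventually.of_forall fun x => (Real.exp_pos _).le)]
  exact ⟨fun h => h.2, fun h => ⟨by fun_prop, h⟩⟩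

theorem integral_exp_eq {F : Type*} [TopologicalSpace F] [MeasurableSpace F] [BorelSpace F]
    [SecondCountableTopology F] {μ : Measure F} {f : F → ℝ} (hf : Continuous f) :
    ∫ x, Real.exp (f x) ∂μ = (∫⁻ x, ENNReal.ofReal (Real.exp (f x)) ∂μ).toReal :=
  integral_eq_lintegral_of_nonneg_ae (Filter.Eventually.of_forall fun x => (Real.exp_pos _).le)
    (by fun_prop)

theorem integral_exp_pos_of_integrable {F : Type*} [TopologicalSpace F] [MeasurableSpace F]
    [BorelSpace F] [SecondCountableTopology F] [Nonempty F] {μ : Measure F} [μ.IsOpenPosMeasure]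
    {f : F → ℝ} (hf : Continuous f) (hi : Integrable (fun x => Real.exp (f x)) μ) :
    0 < ∫ x, Real.exp (f x) ∂μ := by
  rw [integral_exp_eq hf]
  exact ENNReal.toReal_pos (lintegral_exp_ne_zero μ hf) ((integrable_exp_iff hf).1 hi)

theorem ConvexOn.integrable_exp_neg {n : ℕ} {E : Type} [AddCommGroup E] [Module ℝ E]
    {V : E × EuclideanSpace ℝ (Fin n) → ℝ} (hV : ConvexOn ℝ Set.univ V) {t₀ : E}
    (h₀ : Integrable fun x => Real.exp (-V (t₀, x))) (t : E) :
    Integrable fun x => Real.exp (-V (t, x)) :=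
  (integrable_exp_iff (hV.continuous_snd t).neg).2 <| hV.logConcave_lintegral.ne_top
    (fun t => lintegral_exp_ne_zero volume (hV.continuous_snd t).neg)
    ((integrable_exp_iff (hV.continuous_snd t₀).neg).1 h₀) t

/-- **Prékopa's theorem**: marginals of log-concave functions are log-concave. -/
theorem ConvexOn.neg_log_integral_exp_neg {n : ℕ} {E : Type} [AddCommGroup E] [Module ℝ E]
    {V : E × EuclideanSpace ℝ (Fin n) → ℝ} (hV : ConvexOn ℝ Set.univ V)
    (h : ∀ t, Integrable fun x => Real.exp (-V (t, x))) :
    ConvexOn ℝ Set.univ fun t => -Real.log (∫ x, Real.exp (-V (t, x))) := by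
  have := hV.logConcave_lintegral.convexOn
    (fun t => lintegral_exp_ne_zero volume (hV.continuous_snd t).neg)
    (fun t => (integrable_exp_iff (hV.continuous_snd t).neg).1 (h t))
  have e : ∀ t, ∫ x, Real.exp (-V (t, x)) =
      (∫⁻ x, ENNReal.ofReal (Real.exp (-V (t, x)))).toReal := fun t =>
    integral_exp_eq (hV.continuous_snd t).neg
  simpa only [e] using this

/-! ### The log-sum-exp function -/

section LogSumExp

variable {ι : Type} [Fintype ι]

/-- The function `z ↦ log (∑ i, exp (z i))`. -/
noncomputable def logSumExp (z : ι → ℝ) : ℝ := Real.log (∑ i, Real.exp (z i))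

variable [Nonempty ι]

theorem sum_exp_pos (z : ι → ℝ) : 0 < ∑ i, Real.exp (z i) :=
  Finset.sum_pos (fun _ _ => Real.exp_pos _) Finset.univ_nonempty

theorem exp_logSumExp (z : ι → ℝ) : Real.exp (logSumExp z) = ∑ i, Real.exp (z i) :=
  Real.exp_log (sum_exp_pos z)

theorem logSumExp_le_iff {z : ι → ℝ} {a : ℝ} :
    logSumExp z ≤ a ↔ ∑ i, Real.exp (z i) ≤ Real.exp a := by
  rw [← exp_logSumExp, Real.exp_le_exp]

theorem le_logSumExp (z : ι → ℝ) (i : ι) : z i ≤ logSumExp z := by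
  rw [← Real.exp_le_exp, exp_logSumExp]
  exact Finset.single_le_sum (f := fun i => Real.exp (z i)) (fun i _ => (Real.exp_pos _).le)
    (Finset.mem_univ i)

theorem continuous_logSumExp : Continuous (logSumExp : (ι → ℝ) → ℝ) :=
  Continuous.log (by fun_prop) fun z => (sum_exp_pos z).ne'

theorem sum_exp_sub_logSumExp (z : ι → ℝ) : ∑ i, Real.exp (z i - logSumExp z) = 1 := by
  simp_rw [Real.exp_sub, exp_logSumExp, ← Finset.sum_div]
  exact div_self (sum_exp_pos z).ne'

/-- The softmax weights exp(zᵢ - logSumExp z) sum to 1. This splits the mass density into shares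
whose exponents, unlike the whole, are concave. -/
theorem sum_exp_add_logSumExp (θ q : ℝ) (z : ι → ℝ) :
    ∑ i, Real.exp (z i + (θ - 1) * logSumExp z - q) = Real.exp (θ * logSumExp z - q) := by
  have : ∀ i, Real.exp (z i + (θ - 1) * logSumExp z - q) =
      Real.exp (z i - logSumExp z) * Real.exp (θ * logSumExp z - q) := fun i => by
    rw [← Real.exp_add]; ring_nf
  simp_rw [this, ← Finset.sum_mul, sum_exp_sub_logSumExp, one_mul]

theorem logSumExp_add_le (z d : ι → ℝ) {C : ℝ} (hd : ∀ i, d i ≤ C) :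
    logSumExp (z + d) ≤ logSumExp z + C := by
  rw [logSumExp_le_iff, Real.exp_add, exp_logSumExp, Finset.sum_mul]
  refine Finset.sum_le_sum fun i _ => ?_
  rw [← Real.exp_add, Real.exp_le_exp, Pi.add_apply]
  linarith [hd i]

/-- After subtracting their log-sum-exp, both vectors have exponentials summing to 1, and convexity
of exp applies termwise. -/
theorem convexOn_logSumExp : ConvexOn ℝ Set.univ (logSumExp : (ι → ℝ) → ℝ) := by
  refine ⟨convex_univ, fun z _ w _ a b ha hb hab => ?_⟩
  have h : ∑ i, Real.exp (a * (z i - logSumExp z) + b * (w i - logSumExp w)) ≤ 1 := by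
    calc _ ≤ ∑ i, (a * Real.exp (z i - logSumExp z) + b * Real.exp (w i - logSumExp w)) :=
          Finset.sum_le_sum fun i _ => by
            simpa using convexOn_exp.2 (Set.mem_univ (z i - logSumExp z))
              (Set.mem_univ (w i - logSumExp w)) ha hb hab
      _ = 1 := by
          rw [Finset.sum_add_distrib, ← Finset.mul_sum, ← Finset.mul_sum, sum_exp_sub_logSumExp,
            sum_exp_sub_logSumExp, mul_one, mul_one, hab]
  rw [logSumExp_le_iff]
  calc ∑ i, Real.exp ((a • z + b • w) i)
      = (∑ i, Real.exp (a * (z i - logSumExp z) + b * (w i - logSumExp w))) *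
          Real.exp (a • logSumExp z + b • logSumExp w) := by
        rw [Finset.sum_mul]
        refine Finset.sum_congr rfl fun i _ => ?_
        rw [← Real.exp_add]
        simp only [Pi.add_apply, Pi.smul_apply, smul_eq_mul]
        ring_nf
    _ ≤ _ := mul_le_of_le_one_left (Real.exp_pos _).le h

theorem hasDerivAt_exp_logSumExp (θ q : ℝ) (z d : ι → ℝ) (r : ℝ) :
    HasDerivAt (fun r : ℝ => Real.exp (θ * logSumExp (z + r • d) - q))
      (θ * ∑ i, d i * Real.exp ((z + r • d) i + (θ - 1) * logSumExp (z + r • d) - q)) r := by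
  have h1 : HasDerivAt (fun r : ℝ => ∑ i, Real.exp ((z + r • d) i))
      (∑ i, Real.exp ((z + r • d) i) * d i) r := by
    refine HasDerivAt.fun_sum fun i _ => ?_
    simpa using (((hasDerivAt_id r).mul_const (d i)).const_add (z i)).exp
  convert! (((h1.log (sum_exp_pos _).ne').const_mul θ).sub_const q).exp using 1
  rw [← exp_logSumExp, Real.log_exp, Finset.sum_div, Finset.mul_sum, Finset.mul_sum, Finset.mul_sum]
  refine Finset.sum_congr rfl fun i _ => ?_
  have : Real.exp ((z + r • d) i + (θ - 1) * logSumExp (z + r • d) - q) =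
      Real.exp (θ * logSumExp (z + r • d) - q) * (Real.exp ((z + r • d) i) /
        Real.exp (logSumExp (z + r • d))) := by
    rw [← Real.exp_sub, ← Real.exp_add]; ring_nf
  rw [this]
  ring

end LogSumExp

/-! ### Mass, shares and their dependence on a shift -/

section Mass

variable {ι : Type} [Fintype ι] [Nonempty ι]
variable {F : Type} [TopologicalSpace F] {θ : ℝ} {Z : F → ι → ℝ} {u : F → ℝ}

theorem continuous_lseIntegrand (hZ : Continuous Z) (hu : Continuous u) (θ : ℝ) (z : ι → ℝ) :
    Continuous fun x => θ * logSumExp (Z x + z) - u x := by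
  have := continuous_logSumExp (ι := ι)
  fun_prop

theorem continuous_lseShareIntegrand (hZ : Continuous Z) (hu : Continuous u) (θ : ℝ) (z : ι → ℝ)
    (i : ι) : Continuous fun x => (Z x + z) i + (θ - 1) * logSumExp (Z x + z) - u x := by
  have := continuous_logSumExp (ι := ι)
  fun_prop

theorem lseShareIntegrand_le (θ q : ℝ) (z : ι → ℝ) (i : ι) :
    Real.exp (z i + (θ - 1) * logSumExp z - q) ≤ Real.exp (θ * logSumExp z - q) := by
  gcongr
  linarith [le_logSumExp z i]

variable [MeasurableSpace F] [BorelSpace F] {μ : Measure F}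

/-- The total mass `∫ (∑ exp (Z + z)) ^ θ * exp (-u)`. -/
noncomputable def lseMass (μ : Measure F) (θ : ℝ) (Z : F → ι → ℝ) (u : F → ℝ) (z : ι → ℝ) : ℝ :=
  ∫ x, Real.exp (θ * logSumExp (Z x + z) - u x) ∂μ

/-- The share of the index `i` in `lseMass`. -/
noncomputable def lseShare (μ : Measure F) (θ : ℝ) (Z : F → ι → ℝ) (u : F → ℝ) (z : ι → ℝ)
    (i : ι) : ℝ :=
  ∫ x, Real.exp ((Z x + z) i + (θ - 1) * logSumExp (Z x + z) - u x) ∂μ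

theorem integrable_lseShare (hZ : Continuous Z) (hu : Continuous u) {z : ι → ℝ}
    (h : Integrable (fun x => Real.exp (θ * logSumExp (Z x + z) - u x)) μ) (i : ι) :
    Integrable (fun x => Real.exp ((Z x + z) i + (θ - 1) * logSumExp (Z x + z) - u x)) μ := by
  refine h.mono ((continuous_lseShareIntegrand hZ hu θ z i).rexp.aestronglyMeasurable)
    (Filter.Eventually.of_forall fun x => ?_)
  rw [Real.norm_of_nonneg (Real.exp_pos _).le, Real.norm_of_nonneg (Real.exp_pos _).le]
  exact lseShareIntegrand_le _ _ _ i

theorem sum_lseShare (hZ : Continuous Z) (hu : Continuous u) {z : ι → ℝ}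
    (h : Integrable (fun x => Real.exp (θ * logSumExp (Z x + z) - u x)) μ) :
    ∑ i, lseShare μ θ Z u z i = lseMass μ θ Z u z := by
  unfold lseShare lseMass
  rw [← integral_finsetSum _ fun i _ => integrable_lseShare hZ hu h i]
  simp_rw [sum_exp_add_logSumExp]

/-- Changing the shift moves log-sum-exp by at most the sup norm of the change, so the two
integrands are comparable up to a constant. -/
theorem integrable_lseMass (hθ : 0 < θ) (hZ : Continuous Z) (hu : Continuous u) {z : ι → ℝ}
    (h : Integrable (fun x => Real.exp (θ * logSumExp (Z x + z) - u x)) μ) (z' : ι → ℝ) :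
    Integrable (fun x => Real.exp (θ * logSumExp (Z x + z') - u x)) μ := by
  refine (h.const_mul (Real.exp (θ * ‖z' - z‖))).mono
    ((continuous_lseIntegrand hZ hu θ z').rexp.aestronglyMeasurable)
    (Filter.Eventually.of_forall fun x => ?_)
  rw [Real.norm_of_nonneg (Real.exp_pos _).le, Real.norm_of_nonneg (by positivity), ← Real.exp_add]
  gcongr
  have := logSumExp_add_le (Z x + z) (z' - z) fun i =>
    (Real.le_norm_self _).trans (norm_le_pi_norm (z' - z) i)
  rw [add_add_sub_cancel] at this
  nlinarith

theorem lseMass_le (hθ : 0 < θ) (hZ : Continuous Z) (hu : Continuous u)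
    (h : Integrable (fun x => Real.exp (θ * logSumExp (Z x) - u x)) μ) (z z' : ι → ℝ) :
    lseMass μ θ Z u z' ≤ Real.exp (θ * ‖z' - z‖) * lseMass μ θ Z u z := by
  have h0 : Integrable (fun x => Real.exp (θ * logSumExp (Z x + 0) - u x)) μ := by simpa using h
  unfold lseMass
  rw [← integral_const_mul]
  refine integral_mono (integrable_lseMass hθ hZ hu h0 z')
    ((integrable_lseMass hθ hZ hu h0 z).const_mul _) fun x => ?_
  dsimp only
  rw [← Real.exp_add]
  gcongr
  have := logSumExp_add_le (Z x + z) (z' - z) fun i =>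
    (Real.le_norm_self _).trans (norm_le_pi_norm (z' - z) i)
  rw [add_add_sub_cancel] at this
  nlinarith

theorem continuous_lseMass (hθ : 0 < θ) (hZ : Continuous Z) (hu : Continuous u)
    (h : Integrable (fun x => Real.exp (θ * logSumExp (Z x) - u x)) μ) :
    Continuous (lseMass μ θ Z u) := by
  refine continuous_iff_continuousAt.2 fun z => ?_
  have up : ContinuousAt (fun z' => Real.exp (θ * ‖z' - z‖) * lseMass μ θ Z u z) z := by fun_prop
  have lo : ContinuousAt (fun z' => Real.exp (-(θ * ‖z - z'‖)) * lseMass μ θ Z u z) z := by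
    fun_prop
  refine tendsto_of_tendsto_of_tendsto_of_le_of_le (g := fun z' => Real.exp (-(θ * ‖z - z'‖)) *
    lseMass μ θ Z u z) (h := fun z' => Real.exp (θ * ‖z' - z‖) * lseMass μ θ Z u z) ?_ ?_ ?_ ?_
  · simpa [ContinuousAt] using lo
  · simpa [ContinuousAt] using up
  · intro z'
    have := lseMass_le hθ hZ hu h z' z
    dsimp only
    rwa [Real.exp_neg, inv_mul_le_iff₀ (Real.exp_pos _)]
  · exact fun z' => lseMass_le hθ hZ hu h z z'

theorem hasDerivAt_lseMass (hθ : 0 < θ) (hZ : Continuous Z) (hu : Continuous u)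
    (h : Integrable (fun x => Real.exp (θ * logSumExp (Z x) - u x)) μ) (z d : ι → ℝ) :
    HasDerivAt (fun r : ℝ => lseMass μ θ Z u (z + r • d))
      (θ * ∑ i, d i * lseShare μ θ Z u z i) 0 := by
  have h0 : Integrable (fun x => Real.exp (θ * logSumExp (Z x + 0) - u x)) μ := by simpa using h
  have hz := integrable_lseMass hθ hZ hu h0 z
  have key := (hasDerivAt_integral_of_dominated_loc_of_deriv_le (μ := μ) (x₀ := (0 : ℝ))
    (s := Metric.ball 0 1)
    (F := fun r x => Real.exp (θ * logSumExp (Z x + z + r • d) - u x))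
    (F' := fun r x => θ * ∑ i, d i * Real.exp ((Z x + z + r • d) i +
      (θ - 1) * logSumExp (Z x + z + r • d) - u x))
    -- For |r| < 1 the extra shift r d costs at most the factor exp(θ‖d‖), and each share density is
    -- at most the full density.
    (bound := fun x => θ * ∑ _i : ι, ‖d‖ * (Real.exp (θ * ‖d‖) *
      Real.exp (θ * logSumExp (Z x + z) - u x)))
    (Metric.ball_mem_nhds 0 one_pos) (Filter.Eventually.of_forall fun r => ?_) ?_ ?_
    (Filter.Eventually.of_forall fun x r hr => ?_) ?_
    (Filter.Eventually.of_forall fun x r _ => hasDerivAt_exp_logSumExp θ (u x) (Z x + z) d r)).2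
  · simp only [zero_smul, add_zero] at key
    rw [integral_const_mul, integral_finsetSum _ fun i _ =>
      (integrable_lseShare hZ hu hz i).const_mul _] at key
    simp_rw [integral_const_mul] at key
    simpa only [lseMass, lseShare, add_assoc] using key
  · have := continuous_lseIntegrand (hZ.add continuous_const) hu θ (r • d) (Z := fun x => Z x + z)
    exact this.rexp.aestronglyMeasurable
  · simpa using hz
  · have := fun i => continuous_lseShareIntegrand (hZ.add continuous_const) hu θ ((0 : ℝ) • d) i
      (Z := fun x => Z x + z)
    exact (continuous_const.mul (continuous_finsetSum _ fun i _ =>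
      continuous_const.mul (this i).rexp)).aestronglyMeasurable
  · rw [norm_mul, Real.norm_of_nonneg hθ.le]
    gcongr
    refine (norm_sum_le _ _).trans (Finset.sum_le_sum fun i _ => ?_)
    rw [norm_mul, Real.norm_of_nonneg (Real.exp_pos _).le]
    refine mul_le_mul (norm_le_pi_norm d i) ((lseShareIntegrand_le _ _ _ i).trans ?_)
      (Real.exp_pos _).le (norm_nonneg _)
    rw [← Real.exp_add]
    gcongr
    have hr' : ‖r‖ ≤ 1 := by simpa using (mem_ball_zero_iff.1 hr).le
    have := logSumExp_add_le (Z x + z) (r • d) (C := ‖d‖) fun i =>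
      (Real.le_norm_self _).trans ((norm_le_pi_norm (r • d) i).trans (by
        rw [norm_smul]; exact mul_le_of_le_one_left (norm_nonneg _) hr'))
    nlinarith
  · exact (integrable_finsetSum _ fun i _ => (hz.const_mul _).const_mul _).const_mul _

end Mass

/-! ### Extensions linear in time inside the exponentials -/

section Shift

variable {m n : ℕ} {ι : Type}

/-- The affine functions `x ↦ ℓ i x + c i`, as a vector. -/
def affineFamily (ℓ : ι → EuclideanSpace ℝ (Fin n) →L[ℝ] ℝ) (c : ι → ℝ)
    (x : EuclideanSpace ℝ (Fin n)) : ι → ℝ :=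
  fun i => ℓ i x + c i

/-- The linear forms `t ↦ ∑ k, α i k * t k`, as a vector. -/
def linearShift (α : ι → Fin m → ℝ) (t : EuclideanSpace ℝ (Fin m)) : ι → ℝ :=
  fun i => ∑ k, α i k * t k

theorem continuous_affineFamily (ℓ : ι → EuclideanSpace ℝ (Fin n) →L[ℝ] ℝ) (c : ι → ℝ) :
    Continuous (affineFamily ℓ c) := by
  unfold affineFamily
  fun_prop

theorem continuous_linearShift (t : EuclideanSpace ℝ (Fin m)) :
    Continuous fun α : ι → Fin m → ℝ => linearShift α t := by
  unfold linearShift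
  fun_prop

@[simp]
theorem linearShift_zero_right (α : ι → Fin m → ℝ) : linearShift α 0 = 0 := by
  ext i; simp [linearShift]

@[simp]
theorem linearShift_zero_left (t : EuclideanSpace ℝ (Fin m)) :
    linearShift (0 : ι → Fin m → ℝ) t = 0 := by
  ext i; simp [linearShift]

theorem linearShift_add_smul (α β : ι → Fin m → ℝ) (r : ℝ) (t : EuclideanSpace ℝ (Fin m)) :
    linearShift (α + r • β) t = linearShift α t + r • linearShift β t := by
  ext i
  simp [linearShift, add_mul, Finset.sum_add_distrib, Finset.mul_sum, mul_assoc]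

theorem affineFamily_add_linearShift_combo (ℓ : ι → EuclideanSpace ℝ (Fin n) →L[ℝ] ℝ) (c : ι → ℝ)
    (α : ι → Fin m → ℝ) (p q : EuclideanSpace ℝ (Fin m) × EuclideanSpace ℝ (Fin n)) {a b : ℝ}
    (hab : a + b = 1) :
    affineFamily ℓ c (a • p + b • q).2 + linearShift α (a • p + b • q).1 =
      a • (affineFamily ℓ c p.2 + linearShift α p.1) +
        b • (affineFamily ℓ c q.2 + linearShift α q.1) := by
  ext i
  have hc : c i = a * c i + b * c i := by rw [← add_mul, hab, one_mul]
  simp only [affineFamily, linearShift, Prod.snd_add, Prod.fst_add, Prod.smul_fst, Prod.smul_snd,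
    Pi.add_apply, Pi.smul_apply, map_add, map_smul, smul_eq_mul, PiLp.add_apply, PiLp.smul_apply,
    mul_add, Finset.sum_add_distrib, Finset.mul_sum]
  rw [hc]
  simp only [mul_left_comm]
  rw [← hc]
  linarith

variable [Fintype ι] [Nonempty ι]

theorem convexOn_logSumExp_shift (ℓ : ι → EuclideanSpace ℝ (Fin n) →L[ℝ] ℝ) (c : ι → ℝ)
    (α : ι → Fin m → ℝ) : ConvexOn ℝ Set.univ
      fun p : EuclideanSpace ℝ (Fin m) × EuclideanSpace ℝ (Fin n) =>
        logSumExp (affineFamily ℓ c p.2 + linearShift α p.1) := by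
  refine ⟨convex_univ, fun p _ q _ a b ha hb hab => ?_⟩
  dsimp only
  rw [affineFamily_add_linearShift_combo ℓ c α p q hab]
  exact convexOn_logSumExp.2 (Set.mem_univ _) (Set.mem_univ _) ha hb hab

variable {φ : EuclideanSpace ℝ (Fin m) × EuclideanSpace ℝ (Fin n) → ℝ} {θ : ℝ}

/-- The term zᵢ is affine in (t, x), and θ - 1 ≤ 0 turns the convex log-sum-exp into a concave term.
This is where θ ≤ 1 is essential. -/
theorem convexOn_neg_lseShareIntegrand (hφ : ConvexOn ℝ Set.univ φ) (hθ1 : θ ≤ 1)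
    (ℓ : ι → EuclideanSpace ℝ (Fin n) →L[ℝ] ℝ) (c : ι → ℝ) (α : ι → Fin m → ℝ) (i : ι) :
    ConvexOn ℝ Set.univ fun p : EuclideanSpace ℝ (Fin m) × EuclideanSpace ℝ (Fin n) =>
      -((affineFamily ℓ c p.2 + linearShift α p.1) i +
        (θ - 1) * logSumExp (affineFamily ℓ c p.2 + linearShift α p.1) - φ p) := by
  refine ⟨convex_univ, fun p _ q _ a b ha hb hab => ?_⟩
  have h1 := (convexOn_logSumExp_shift ℓ c α).2 (Set.mem_univ p) (Set.mem_univ q) ha hb hab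
  have h2 := hφ.2 (Set.mem_univ p) (Set.mem_univ q) ha hb hab
  have h3 := congrFun (affineFamily_add_linearShift_combo ℓ c α p q hab) i
  have h4 := mul_le_mul_of_nonneg_left h1 (sub_nonneg.2 hθ1)
  simp only [smul_eq_mul, Pi.add_apply (a • _), Pi.smul_apply] at h1 h2 h3 h4 ⊢
  rw [h3]
  linarith

/-- Prékopa's theorem carries integrability from time 0 to time t for each share with zero slopes;
the shares are then added up. -/
theorem integrable_exp_logSumExp_sub (hφ : ConvexOn ℝ Set.univ φ) (hθ1 : θ ≤ 1)
    (ℓ : ι → EuclideanSpace ℝ (Fin n) →L[ℝ] ℝ) (c : ι → ℝ)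
    (h0 : Integrable fun x => Real.exp (θ * logSumExp (affineFamily ℓ c x) - φ (0, x)))
    (t : EuclideanSpace ℝ (Fin m)) :
    Integrable fun x => Real.exp (θ * logSumExp (affineFamily ℓ c x) - φ (t, x)) := by
  have hs : ∀ i, Integrable fun x => Real.exp (affineFamily ℓ c x i +
      (θ - 1) * logSumExp (affineFamily ℓ c x) - φ (t, x)) := fun i => by
    have := (convexOn_neg_lseShareIntegrand hφ hθ1 ℓ c 0 i).integrable_exp_neg (t₀ := 0) (by
      simp only [neg_neg, linearShift_zero_left]
      refine integrable_lseShare (continuous_affineFamily ℓ c) (hφ.continuous_snd 0) ?_ i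
      simpa using h0) t
    simpa using this
  simpa only [sum_exp_add_logSumExp] using integrable_finsetSum Finset.univ fun i _ => hs i

/-- The mass at time `t` of the function `θ * logSumExp` extended linearly by `α`. -/
noncomputable def shiftMass (φ : EuclideanSpace ℝ (Fin m) × EuclideanSpace ℝ (Fin n) → ℝ) (θ : ℝ)
    (ℓ : ι → EuclideanSpace ℝ (Fin n) →L[ℝ] ℝ) (c : ι → ℝ) (α : ι → Fin m → ℝ)
    (t : EuclideanSpace ℝ (Fin m)) : ℝ :=
  lseMass volume θ (affineFamily ℓ c) (fun x => φ (t, x)) (linearShift α t)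

/-- The share of the index `i` in `shiftMass`. -/
noncomputable def shiftShare (φ : EuclideanSpace ℝ (Fin m) × EuclideanSpace ℝ (Fin n) → ℝ) (θ : ℝ)
    (ℓ : ι → EuclideanSpace ℝ (Fin n) →L[ℝ] ℝ) (c : ι → ℝ) (α : ι → Fin m → ℝ)
    (t : EuclideanSpace ℝ (Fin m)) (i : ι) : ℝ :=
  lseShare volume θ (affineFamily ℓ c) (fun x => φ (t, x)) (linearShift α t) i

theorem integrable_shiftMass (hφ : ConvexOn ℝ Set.univ φ) (hθ : 0 < θ) (hθ1 : θ ≤ 1)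
    (ℓ : ι → EuclideanSpace ℝ (Fin n) →L[ℝ] ℝ) (c : ι → ℝ)
    (h0 : Integrable fun x => Real.exp (θ * logSumExp (affineFamily ℓ c x) - φ (0, x)))
    (α : ι → Fin m → ℝ) (t : EuclideanSpace ℝ (Fin m)) :
    Integrable fun x => Real.exp
      (θ * logSumExp (affineFamily ℓ c x + linearShift α t) - φ (t, x)) :=
  integrable_lseMass hθ (continuous_affineFamily ℓ c) (hφ.continuous_snd t) (z := 0)
    (by simpa using integrable_exp_logSumExp_sub hφ hθ1 ℓ c h0 t) _

theorem shiftMass_pos (hφ : ConvexOn ℝ Set.univ φ) (hθ : 0 < θ) (hθ1 : θ ≤ 1)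
    (ℓ : ι → EuclideanSpace ℝ (Fin n) →L[ℝ] ℝ) (c : ι → ℝ)
    (h0 : Integrable fun x => Real.exp (θ * logSumExp (affineFamily ℓ c x) - φ (0, x)))
    (α : ι → Fin m → ℝ) (t : EuclideanSpace ℝ (Fin m)) :
    0 < shiftMass φ θ ℓ c α t :=
  integral_exp_pos_of_integrable
    (continuous_lseIntegrand (continuous_affineFamily ℓ c) (hφ.continuous_snd t) θ _)
    (integrable_shiftMass hφ hθ hθ1 ℓ c h0 α t)

theorem shiftShare_pos (hφ : ConvexOn ℝ Set.univ φ) (hθ : 0 < θ) (hθ1 : θ ≤ 1)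
    (ℓ : ι → EuclideanSpace ℝ (Fin n) →L[ℝ] ℝ) (c : ι → ℝ)
    (h0 : Integrable fun x => Real.exp (θ * logSumExp (affineFamily ℓ c x) - φ (0, x)))
    (α : ι → Fin m → ℝ) (t : EuclideanSpace ℝ (Fin m)) (i : ι) :
    0 < shiftShare φ θ ℓ c α t i :=
  integral_exp_pos_of_integrable
    (continuous_lseShareIntegrand (continuous_affineFamily ℓ c) (hφ.continuous_snd t) θ _ i)
    (integrable_lseShare (continuous_affineFamily ℓ c) (hφ.continuous_snd t)
      (integrable_shiftMass hφ hθ hθ1 ℓ c h0 α t) i)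

theorem sum_shiftShare (hφ : ConvexOn ℝ Set.univ φ) (hθ : 0 < θ) (hθ1 : θ ≤ 1)
    (ℓ : ι → EuclideanSpace ℝ (Fin n) →L[ℝ] ℝ) (c : ι → ℝ)
    (h0 : Integrable fun x => Real.exp (θ * logSumExp (affineFamily ℓ c x) - φ (0, x)))
    (α : ι → Fin m → ℝ) (t : EuclideanSpace ℝ (Fin m)) :
    ∑ i, shiftShare φ θ ℓ c α t i = shiftMass φ θ ℓ c α t :=
  sum_lseShare (continuous_affineFamily ℓ c) (hφ.continuous_snd t)
    (integrable_shiftMass hφ hθ hθ1 ℓ c h0 α t)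

theorem convexOn_neg_log_shiftShare (hφ : ConvexOn ℝ Set.univ φ) (hθ : 0 < θ) (hθ1 : θ ≤ 1)
    (ℓ : ι → EuclideanSpace ℝ (Fin n) →L[ℝ] ℝ) (c : ι → ℝ)
    (h0 : Integrable fun x => Real.exp (θ * logSumExp (affineFamily ℓ c x) - φ (0, x)))
    (α : ι → Fin m → ℝ) (i : ι) :
    ConvexOn ℝ Set.univ fun t => -Real.log (shiftShare φ θ ℓ c α t i) := by
  have := (convexOn_neg_lseShareIntegrand hφ hθ1 ℓ c α i).neg_log_integral_exp_neg fun t => by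
    simpa only [neg_neg] using integrable_lseShare (continuous_affineFamily ℓ c)
      (hφ.continuous_snd t) (integrable_shiftMass hφ hθ hθ1 ℓ c h0 α t) i
  simp only [neg_neg] at this
  exact this

theorem continuous_shiftMass (hφ : ConvexOn ℝ Set.univ φ) (hθ : 0 < θ) (hθ1 : θ ≤ 1)
    (ℓ : ι → EuclideanSpace ℝ (Fin n) →L[ℝ] ℝ) (c : ι → ℝ)
    (h0 : Integrable fun x => Real.exp (θ * logSumExp (affineFamily ℓ c x) - φ (0, x)))
    (t : EuclideanSpace ℝ (Fin m)) :
    Continuous fun α => shiftMass φ θ ℓ c α t :=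
  (continuous_lseMass hθ (continuous_affineFamily ℓ c) (hφ.continuous_snd t)
    (integrable_exp_logSumExp_sub hφ hθ1 ℓ c h0 t)).comp (continuous_linearShift t)

theorem hasDerivAt_shiftMass (hφ : ConvexOn ℝ Set.univ φ) (hθ : 0 < θ) (hθ1 : θ ≤ 1)
    (ℓ : ι → EuclideanSpace ℝ (Fin n) →L[ℝ] ℝ) (c : ι → ℝ)
    (h0 : Integrable fun x => Real.exp (θ * logSumExp (affineFamily ℓ c x) - φ (0, x)))
    (α β : ι → Fin m → ℝ) (t : EuclideanSpace ℝ (Fin m)) :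
    HasDerivAt (fun r : ℝ => shiftMass φ θ ℓ c (α + r • β) t)
      (θ * ∑ i, linearShift β t i * shiftShare φ θ ℓ c α t i) 0 := by
  simp only [shiftMass, linearShift_add_smul]
  exact hasDerivAt_lseMass hθ (continuous_affineFamily ℓ c) (hφ.continuous_snd t)
    (integrable_exp_logSumExp_sub hφ hθ1 ℓ c h0 t) _ _

/-- A bound on the mass at time `t` bounds the shifts from above. -/
theorem linearShift_le_of_shiftMass_le (hφ : ConvexOn ℝ Set.univ φ) (hθ : 0 < θ) (hθ1 : θ ≤ 1)
    (ℓ : ι → EuclideanSpace ℝ (Fin n) →L[ℝ] ℝ) (c : ι → ℝ)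
    (h0 : Integrable fun x => Real.exp (θ * logSumExp (affineFamily ℓ c x) - φ (0, x)))
    (t : EuclideanSpace ℝ (Fin m)) (R : ℝ) :
    ∃ C, ∀ α : ι → Fin m → ℝ, shiftMass φ θ ℓ c α t ≤ R → ∀ i, linearShift α t i ≤ C := by
  have hc : ∀ i, Continuous fun x => θ * affineFamily ℓ c x i - φ (t, x) := fun i =>
    (continuous_const.mul ((continuous_apply i).comp (continuous_affineFamily ℓ c))).sub
      (hφ.continuous_snd t)
  have hi : ∀ i, Integrable fun x => Real.exp (θ * affineFamily ℓ c x i - φ (t, x)) := fun i => by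
    refine (integrable_exp_logSumExp_sub hφ hθ1 ℓ c h0 t).mono
      (hc i).rexp.aestronglyMeasurable (Filter.Eventually.of_forall fun x => ?_)
    rw [Real.norm_of_nonneg (Real.exp_pos _).le, Real.norm_of_nonneg (Real.exp_pos _).le]
    gcongr
    exact le_logSumExp _ i
  -- Keeping only the i-th exponential bounds the mass below by κ i times exp(θ αᵢ·t).
  set κ : ι → ℝ := fun i => ∫ x, Real.exp (θ * affineFamily ℓ c x i - φ (t, x)) with hκ
  have hκ0 : ∀ i, 0 < κ i := fun i => integral_exp_pos_of_integrable (hc i) (hi i)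
  obtain ⟨C, hC⟩ := Finite.bddAbove_range fun i => Real.log (R / κ i) / θ
  refine ⟨C, fun α hα i => le_trans ?_ (hC ⟨i, rfl⟩)⟩
  have h : Real.exp (θ * linearShift α t i) * κ i ≤ R := by
    refine le_trans ?_ hα
    rw [hκ, ← integral_const_mul]
    refine integral_mono ((hi i).const_mul _) (integrable_shiftMass hφ hθ hθ1 ℓ c h0 α t)
      fun x => ?_
    dsimp only
    rw [← Real.exp_add]
    gcongr
    have := le_logSumExp (affineFamily ℓ c x + linearShift α t) i
    rw [Pi.add_apply] at this
    nlinarith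
  rw [le_div_iff₀ hθ, mul_comm, Real.le_log_iff_exp_le]
  · rwa [le_div_iff₀ (hκ0 i)]
  · exact div_pos ((mul_pos (Real.exp_pos _) (hκ0 i)).trans_le h) (hκ0 i)

/-- The mass at t bounds αᵢ·t only from above; having both eₖ and -eₖ in T bounds every slope
coordinate on both sides, so the objective has bounded sublevel sets. -/
theorem exists_shift_isMin (hφ : ConvexOn ℝ Set.univ φ) (hθ : 0 < θ) (hθ1 : θ ≤ 1)
    (ℓ : ι → EuclideanSpace ℝ (Fin n) →L[ℝ] ℝ) (c : ι → ℝ)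
    (h0 : Integrable fun x => Real.exp (θ * logSumExp (affineFamily ℓ c x) - φ (0, x)))
    (T : Finset (EuclideanSpace ℝ (Fin m)))
    (hT : ∀ k, EuclideanSpace.single k 1 ∈ T) (hT' : ∀ k, EuclideanSpace.single k (-1) ∈ T)
    (p : ℕ) : ∃ α : ι → Fin m → ℝ, ∀ β : ι → Fin m → ℝ,
      ∑ t ∈ T, shiftMass φ θ ℓ c α t ^ (p + 1) ≤ ∑ t ∈ T, shiftMass φ θ ℓ c β t ^ (p + 1) := by
  set J : (ι → Fin m → ℝ) → ℝ := fun α => ∑ t ∈ T, shiftMass φ θ ℓ c α t ^ (p + 1) with hJ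
  have hJc : Continuous J :=
    continuous_finsetSum _ fun t _ => (continuous_shiftMass hφ hθ hθ1 ℓ c h0 t).pow _
  -- The 1 serves masses above 1, which are dominated by their own (p+1)-st power.
  set R := max 1 (J 0)
  have hM : ∀ α, J α ≤ J 0 → ∀ t ∈ T, shiftMass φ θ ℓ c α t ≤ R := by
    intro α hα t ht
    by_contra! hlt
    have h1 : 1 < shiftMass φ θ ℓ c α t := (le_max_left _ _).trans_lt hlt
    have h2 : shiftMass φ θ ℓ c α t ^ (p + 1) ≤ J α :=
      Finset.single_le_sum (f := fun t => shiftMass φ θ ℓ c α t ^ (p + 1))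
        (fun t _ => (pow_pos (shiftMass_pos hφ hθ hθ1 ℓ c h0 α t) _).le) ht
    have h3 : shiftMass φ θ ℓ c α t ≤ shiftMass φ θ ℓ c α t ^ (p + 1) :=
      le_self_pow₀ h1.le (by simp)
    exact absurd hlt (not_lt.2 (h3.trans (h2.trans (hα.trans (le_max_right _ _)))))
  choose C hC using fun t => linearShift_le_of_shiftMass_le hφ hθ hθ1 ℓ c h0 t R
  obtain ⟨D, hD⟩ := (T.finite_toSet.image C).bddAbove
  have hbd : ∀ α, J α ≤ J 0 → ‖α‖ ≤ max D 0 := by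
    intro α hα
    have hle : ∀ t ∈ T, ∀ i, linearShift α t i ≤ D := fun t ht i =>
      (hC t α (hM α hα t ht) i).trans (hD ⟨t, ht, rfl⟩)
    refine (pi_norm_le_iff_of_nonneg (le_max_right _ _)).2 fun i =>
      (pi_norm_le_iff_of_nonneg (le_max_right _ _)).2 fun k => ?_
    have h1 := hle _ (hT k) i
    have h2 := hle _ (hT' k) i
    simp only [linearShift, PiLp.single_apply, mul_ite, mul_one, mul_neg, mul_zero,
      Finset.sum_ite_eq', Finset.mem_univ, if_true] at h1 h2
    exact (abs_le.2 ⟨by linarith, h1⟩).trans (le_max_left _ _)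
  obtain ⟨α, -, hα⟩ := (isCompact_closedBall (0 : ι → Fin m → ℝ) (max D 0)).exists_isMinOn
    ⟨0, by simp⟩ hJc.continuousOn
  refine ⟨α, fun β => ?_⟩
  by_cases hβ : J β ≤ J 0
  · exact hα (mem_closedBall_zero_iff.2 (hbd β hβ))
  · exact (hα (a := 0) (by simp)).trans (not_le.1 hβ).le

end Shift

/-! ### Optimal slopes and the mass bound -/

section Optimal

variable {m n : ℕ} {ι : Type} [Fintype ι] [Nonempty ι]
  {φ : EuclideanSpace ℝ (Fin m) × EuclideanSpace ℝ (Fin n) → ℝ} {θ : ℝ}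

/-- First-order condition at a minimiser of `∑ t ∈ T, shiftMass ^ (p + 1)`. -/
theorem sum_smul_eq_zero_of_isMin (hφ : ConvexOn ℝ Set.univ φ) (hθ : 0 < θ) (hθ1 : θ ≤ 1)
    (ℓ : ι → EuclideanSpace ℝ (Fin n) →L[ℝ] ℝ) (c : ι → ℝ)
    (h0 : Integrable fun x => Real.exp (θ * logSumExp (affineFamily ℓ c x) - φ (0, x)))
    (T : Finset (EuclideanSpace ℝ (Fin m))) (p : ℕ) {α : ι → Fin m → ℝ}
    (hα : ∀ β : ι → Fin m → ℝ,
      ∑ t ∈ T, shiftMass φ θ ℓ c α t ^ (p + 1) ≤ ∑ t ∈ T, shiftMass φ θ ℓ c β t ^ (p + 1))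
    (i : ι) : ∑ t ∈ T, (shiftMass φ θ ℓ c α t ^ p * shiftShare φ θ ℓ c α t i) • t = 0 := by
  classical
  set v := ∑ t ∈ T, (shiftMass φ θ ℓ c α t ^ p * shiftShare φ θ ℓ c α t i) • t with hv
  -- Perturbing only the i-th slope, in the direction v itself, makes the derivative a positive
  -- multiple of |v|².
  set β : ι → Fin m → ℝ := Pi.single i fun k => v k with hβ
  have hder : HasDerivAt (fun r : ℝ => ∑ t ∈ T, shiftMass φ θ ℓ c (α + r • β) t ^ (p + 1))
      (∑ t ∈ T, ((p + 1 : ℕ) : ℝ) * shiftMass φ θ ℓ c α t ^ p *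
        (θ * ∑ j, linearShift β t j * shiftShare φ θ ℓ c α t j)) 0 := by
    refine HasDerivAt.fun_sum fun t _ => ?_
    simpa using (hasDerivAt_shiftMass hφ hθ hθ1 ℓ c h0 α β t).fun_pow (p + 1)
  have hmin : IsLocalMin (fun r : ℝ => ∑ t ∈ T, shiftMass φ θ ℓ c (α + r • β) t ^ (p + 1)) 0 :=
    Filter.Eventually.of_forall fun r => by simpa using hα (α + r • β)
  have hz := hmin.hasDerivAt_eq_zero hder
  have hβs : ∀ t : EuclideanSpace ℝ (Fin m), ∑ j, linearShift β t j * shiftShare φ θ ℓ c α t j =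
      (∑ k, v k * t k) * shiftShare φ θ ℓ c α t i := fun t => by
    rw [Finset.sum_eq_single i]
    · simp [linearShift, hβ]
    · intro j _ hj
      simp [linearShift, hβ, hj]
    · simp
  have hsum : ∑ t ∈ T, ((p + 1 : ℕ) : ℝ) * shiftMass φ θ ℓ c α t ^ p *
        (θ * ∑ j, linearShift β t j * shiftShare φ θ ℓ c α t j) =
      ((p + 1 : ℕ) * θ) * ∑ k, v k * v k := by
    have hvk : ∀ k, v k =
        ∑ t ∈ T, shiftMass φ θ ℓ c α t ^ p * shiftShare φ θ ℓ c α t i * t k := fun k => by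
      simp [hv]
    have : ∑ k, v k * v k = ∑ t ∈ T, shiftMass φ θ ℓ c α t ^ p *
        ((∑ k, v k * t k) * shiftShare φ θ ℓ c α t i) := by
      calc ∑ k, v k * v k = ∑ k, ∑ t ∈ T, v k *
            (shiftMass φ θ ℓ c α t ^ p * shiftShare φ θ ℓ c α t i * t k) := by
            refine Finset.sum_congr rfl fun k _ => ?_
            rw [← Finset.mul_sum, ← hvk]
        _ = _ := by
            rw [Finset.sum_comm]
            refine Finset.sum_congr rfl fun t _ => ?_
            rw [Finset.sum_mul, Finset.mul_sum]
            refine Finset.sum_congr rfl fun k _ => by ring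
    rw [this, Finset.mul_sum]
    refine Finset.sum_congr rfl fun t _ => ?_
    rw [hβs]
    ring
  rw [hsum, mul_eq_zero, or_iff_right (by positivity),
    Finset.sum_eq_zero_iff_of_nonneg fun k _ => mul_self_nonneg _] at hz
  ext k
  simpa using hz k (Finset.mem_univ k)

theorem exists_sum_shiftMass_pow_le (hφ : ConvexOn ℝ Set.univ φ) (hθ : 0 < θ) (hθ1 : θ ≤ 1)
    (ℓ : ι → EuclideanSpace ℝ (Fin n) →L[ℝ] ℝ) (c : ι → ℝ)
    (h0 : Integrable fun x => Real.exp (θ * logSumExp (affineFamily ℓ c x) - φ (0, x)))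
    (h1 : ∫ x, Real.exp (θ * logSumExp (affineFamily ℓ c x) - φ (0, x)) ≤ 1)
    (T : Finset (EuclideanSpace ℝ (Fin m)))
    (hT : ∀ k, EuclideanSpace.single k 1 ∈ T) (hT' : ∀ k, EuclideanSpace.single k (-1) ∈ T)
    (p : ℕ) : ∃ α : ι → Fin m → ℝ, ∑ t ∈ T, shiftMass φ θ ℓ c α t ^ (p + 1) ≤ T.card := by
  rcases T.eq_empty_or_nonempty with rfl | hTn
  · exact ⟨0, by simp⟩
  obtain ⟨α, hα⟩ := exists_shift_isMin hφ hθ hθ1 ℓ c h0 T hT hT' p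
  refine ⟨α, ?_⟩
  set M := fun t => shiftMass φ θ ℓ c α t with hM
  set G := fun t i => shiftShare φ θ ℓ c α t i with hG
  have hM0 : ∀ t, 0 < M t := shiftMass_pos hφ hθ hθ1 ℓ c h0 α
  have hG0 : ∀ t i, 0 < G t i := shiftShare_pos hφ hθ hθ1 ℓ c h0 α
  have hMG : ∀ t, ∑ i, G t i = M t := sum_shiftShare hφ hθ hθ1 ℓ c h0 α
  have hM1 : M 0 ≤ 1 := by simpa [hM, shiftMass, lseMass] using h1
  -- Jensen for the convex function -log Gᵢ, at weights whose barycentre is 0 by stationarity.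
  have jensen : ∀ i, 0 ≤ ∑ t ∈ T, M t ^ p * G t i * (Real.log (G 0 i) - Real.log (G t i)) := by
    intro i
    have hw : ∀ t, 0 < M t ^ p * G t i := fun t => mul_pos (pow_pos (hM0 t) p) (hG0 t i)
    have hq : 0 < ∑ t ∈ T, M t ^ p * G t i := Finset.sum_pos (fun t _ => hw t) hTn
    have := (convexOn_neg_log_shiftShare hφ hθ hθ1 ℓ c h0 α i).map_centerMass_le
      (t := T) (w := fun t => M t ^ p * G t i) (p := id) (fun t _ => (hw t).le) hq
      (fun t _ => Set.mem_univ _)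
    simp only [Finset.centerMass, id, sum_smul_eq_zero_of_isMin hφ hθ hθ1 ℓ c h0 T p hα i,
      smul_zero, hM, hG, smul_eq_mul] at this
    rw [inv_mul_eq_div, le_div_iff₀ hq] at this
    simp only [hM, hG, mul_sub, Finset.sum_sub_distrib, Function.comp_apply, id, mul_neg,
      Finset.sum_neg_distrib, ← Finset.sum_mul] at this ⊢
    linarith
  -- This is log y ≤ y - 1 at y = Gᵢ(0) M(t) / Gᵢ(t); the factor M(t) makes the remainder sum over i
  -- to (M(0) - 1) M(t)^(p+1) ≤ 0.
  have bound : ∀ t i, M t ^ p * G t i * (Real.log (G 0 i) - Real.log (G t i)) ≤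
      -(M t ^ p * G t i * Real.log (M t)) + (G 0 i * M t ^ (p + 1) - M t ^ p * G t i) := by
    intro t i
    have h := Real.log_le_sub_one_of_pos (div_pos (mul_pos (hG0 0 i) (hM0 t)) (hG0 t i))
    rw [Real.log_div (mul_pos (hG0 0 i) (hM0 t)).ne' (hG0 t i).ne',
      Real.log_mul (hG0 0 i).ne' (hM0 t).ne'] at h
    have h' := mul_le_mul_of_nonneg_left h (mul_pos (pow_pos (hM0 t) p) (hG0 t i)).le
    have e : M t ^ p * G t i * (G 0 i * M t / G t i - 1) =
        G 0 i * M t ^ (p + 1) - M t ^ p * G t i := by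
      have := (hG0 t i).ne'
      field_simp
      ring
    linarith
  have hsum : ∀ t, ∑ i, (-(M t ^ p * G t i * Real.log (M t)) +
      (G 0 i * M t ^ (p + 1) - M t ^ p * G t i)) =
      -(M t ^ (p + 1) * Real.log (M t)) + (M 0 - 1) * M t ^ (p + 1) := by
    intro t
    rw [Finset.sum_add_distrib, Finset.sum_sub_distrib, Finset.sum_neg_distrib, ← Finset.sum_mul,
      ← Finset.sum_mul, ← Finset.mul_sum, hMG, hMG]
    ring
  have hpos : 0 ≤ ∑ t ∈ T, -(M t ^ (p + 1) * Real.log (M t)) := by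
    calc 0 ≤ ∑ i, ∑ t ∈ T, M t ^ p * G t i * (Real.log (G 0 i) - Real.log (G t i)) :=
          Finset.sum_nonneg fun i _ => jensen i
      _ ≤ ∑ i, ∑ t ∈ T, (-(M t ^ p * G t i * Real.log (M t)) +
            (G 0 i * M t ^ (p + 1) - M t ^ p * G t i)) :=
          Finset.sum_le_sum fun i _ => Finset.sum_le_sum fun t _ => bound t i
      _ = ∑ t ∈ T, (-(M t ^ (p + 1) * Real.log (M t)) + (M 0 - 1) * M t ^ (p + 1)) := by
          rw [Finset.sum_comm]
          exact Finset.sum_congr rfl fun t _ => hsum t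
      _ ≤ _ := Finset.sum_le_sum fun t _ => by
          have := mul_nonneg (sub_nonneg.2 hM1) (pow_pos (hM0 t) (p + 1)).le
          linarith
  -- The inequality y - 1 ≤ y log y with y = M(t)^(p+1).
  have hlog : ∀ t, M t ^ (p + 1) - 1 ≤ (p + 1) * (M t ^ (p + 1) * Real.log (M t)) := by
    intro t
    have hy := pow_pos (hM0 t) (p + 1)
    have h := mul_le_mul_of_nonneg_left (Real.one_sub_inv_le_log_of_pos hy) hy.le
    rw [mul_sub, mul_one, mul_inv_cancel₀ hy.ne', Real.log_pow] at h
    push_cast at h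
    linarith
  have hfin : ∑ t ∈ T, (M t ^ (p + 1) - 1) ≤ 0 := by
    refine (Finset.sum_le_sum fun t _ => hlog t).trans ?_
    rw [← Finset.mul_sum]
    rw [Finset.sum_neg_distrib] at hpos
    exact mul_nonpos_of_nonneg_of_nonpos (by positivity) (by linarith)
  simpa using hfin

theorem exists_shiftMass_le (hφ : ConvexOn ℝ Set.univ φ) (hθ : 0 < θ) (hθ1 : θ ≤ 1)
    (ℓ : ι → EuclideanSpace ℝ (Fin n) →L[ℝ] ℝ) (c : ι → ℝ)
    (h0 : Integrable fun x => Real.exp (θ * logSumExp (affineFamily ℓ c x) - φ (0, x)))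
    (h1 : ∫ x, Real.exp (θ * logSumExp (affineFamily ℓ c x) - φ (0, x)) ≤ 1)
    (T : Finset (EuclideanSpace ℝ (Fin m))) {ε : ℝ} (hε : 0 < ε) :
    ∃ α : ι → Fin m → ℝ, ∀ t ∈ T, shiftMass φ θ ℓ c α t ≤ 1 + ε := by
  classical
  set T' := T ∪ (Finset.univ.image fun k => EuclideanSpace.single k (1 : ℝ)) ∪
    (Finset.univ.image fun k => EuclideanSpace.single k (-1 : ℝ)) with hT'
  obtain ⟨p, hp⟩ := pow_unbounded_of_one_lt (T'.card : ℝ) (lt_add_of_pos_right 1 hε)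
  obtain ⟨α, hα⟩ := exists_sum_shiftMass_pow_le hφ hθ hθ1 ℓ c h0 h1 T' (by simp [hT'])
    (by simp [hT']) p
  refine ⟨α, fun t ht => le_of_pow_le_pow_left₀ (n := p + 1) (by simp) (by positivity) ?_⟩
  calc _ ≤ ∑ t ∈ T', shiftMass φ θ ℓ c α t ^ (p + 1) :=
        Finset.single_le_sum (f := fun t => shiftMass φ θ ℓ c α t ^ (p + 1))
          (fun t _ => (pow_pos (shiftMass_pos hφ hθ hθ1 ℓ c h0 α t) _).le) (by simp [hT', ht])
    _ ≤ T'.card := hα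
    _ ≤ (1 + ε) ^ p := hp.le
    _ ≤ (1 + ε) ^ (p + 1) := pow_le_pow_right₀ (by linarith) (by simp)

end Optimal

/-! ### Compactness and limits of convex functions -/

/-- The affine span is closed and dense, hence everything, so S has nonempty interior; a convex set
with interior has the same interior as its closure. -/
theorem Convex.eq_univ_of_dense {E : Type} [NormedAddCommGroup E] [NormedSpace ℝ E]
    [FiniteDimensional ℝ E] {S : Set E} (hS : Convex ℝ S) (hd : Dense S) : S = Set.univ := by
  have hspan : affineSpan ℝ S = ⊤ := by
    have hc : IsClosed (affineSpan ℝ S : Set E) := AffineSubspace.closed_of_finiteDimensional _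
    have := hd.mono (subset_affineSpan ℝ S)
    rw [← SetLike.coe_set_eq, AffineSubspace.top_coe, ← hc.closure_eq, this.closure_eq]
  have hint := hS.interior_nonempty_iff_affineSpan_eq_top.2 hspan
  have := hS.interior_closure_eq_interior_of_nonempty_interior hint
  rw [hd.closure_eq, interior_univ] at this
  exact Set.univ_subset_iff.1 (this ▸ interior_subset)

/-- Fatou's lemma for exponentials of functions that are asymptotically bounded below. -/
theorem lintegral_exp_le_of_eventually {F : Type} [MeasurableSpace F] {μ : Measure F}
    {f : F → ℝ} {g : ℕ → F → ℝ} (hg : ∀ i, Measurable (g i))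
    (h : ∀ x, ∀ δ > 0, ∀ᶠ i in atTop, f x - δ ≤ g i x) {b : ℕ → ENNReal} {B : ENNReal}
    (hb : Tendsto b atTop (𝓝 B))
    (hgb : ∀ᶠ i in atTop, ∫⁻ x, ENNReal.ofReal (Real.exp (g i x)) ∂μ ≤ b i) :
    ∫⁻ x, ENNReal.ofReal (Real.exp (f x)) ∂μ ≤ B := by
  calc ∫⁻ x, ENNReal.ofReal (Real.exp (f x)) ∂μ
      ≤ ∫⁻ x, liminf (fun i => ENNReal.ofReal (Real.exp (g i x))) atTop ∂μ := by
        refine lintegral_mono fun x => ?_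
        have hc : Tendsto (fun k : ℕ => ENNReal.ofReal (Real.exp (f x - 1 / ((k : ℝ) + 1)))) atTop
            (𝓝 (ENNReal.ofReal (Real.exp (f x)))) := by
          refine ENNReal.tendsto_ofReal ((Real.continuous_exp.tendsto _).comp ?_)
          simpa using tendsto_one_div_add_atTop_nhds_zero_nat.const_sub (f x)
        refine le_of_tendsto' hc fun k => le_liminf_of_le ?_ ?_
        · isBoundedDefault
        · filter_upwards [h x _ (Nat.one_div_pos_of_nat (n := k))] with i hi
          gcongr
    _ ≤ liminf (fun i => ∫⁻ x, ENNReal.ofReal (Real.exp (g i x)) ∂μ) atTop :=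
        lintegral_liminf_le fun i => (Real.measurable_exp.comp (hg i)).ennreal_ofReal
    _ ≤ liminf b atTop := liminf_le_liminf hgb
    _ = B := hb.liminf_eq

/-- A convex function is bounded at a point by its exponential integral. -/
theorem exists_forall_le_of_lintegral_exp_le {F : Type} [NormedAddCommGroup F]
    [NormedSpace ℝ F] [FiniteDimensional ℝ F] [MeasurableSpace F] [BorelSpace F] (μ : Measure F)
    [μ.IsAddHaarMeasure] {u : F → ℝ} (hu : Continuous u) (x : F) {B : ENNReal} (hB : B ≠ ⊤) :
    ∃ C, ∀ f : F → ℝ, ConvexOn ℝ Set.univ f →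
      ∫⁻ y, ENNReal.ofReal (Real.exp (f y - u y)) ∂μ ≤ B → f x ≤ C := by
  have : ProperSpace F := FiniteDimensional.proper ℝ F
  obtain ⟨K, hK⟩ := (isCompact_closedBall x 1).bddAbove_image hu.continuousOn
  set b := μ (Metric.ball x 1) with hb
  have hb0 : b ≠ 0 := (Metric.measure_ball_pos μ x one_pos).ne'
  have hbt : b ≠ ⊤ := measure_ball_lt_top.ne
  refine ⟨K + Real.log (2 * B / b).toReal, fun f hf hfB => ?_⟩
  have hfc : Continuous f := continuousOn_univ.1 (hf.continuousOn isOpen_univ)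
  set A := {y | f x ≤ f y} ∩ Metric.ball x 1 with hA
  have hAm : MeasurableSet A :=
    (isClosed_le continuous_const hfc).measurableSet.inter measurableSet_ball
  have hrefl : MeasurePreserving (fun y => (2 : ℝ) • x - y) μ μ :=
    Measure.measurePreserving_sub_left μ _
  -- By midpoint convexity f is at least f x at y or at its reflection through x, so A fills at
  -- least half of the ball.
  have hcover : Metric.ball x 1 ⊆ A ∪ (fun y => (2 : ℝ) • x - y) ⁻¹' A := by
    intro y hy
    by_cases h : f x ≤ f y
    · exact Or.inl ⟨h, hy⟩
    · refine Or.inr ⟨?_, ?_⟩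
      · have := hf.2 (Set.mem_univ y) (Set.mem_univ ((2 : ℝ) • x - y))
          (show (0 : ℝ) ≤ 1 / 2 by norm_num) (show (0 : ℝ) ≤ 1 / 2 by norm_num) (by norm_num)
        have e : (1 / 2 : ℝ) • y + (1 / 2 : ℝ) • ((2 : ℝ) • x - y) = x := by module
        rw [e] at this
        simp only [smul_eq_mul] at this
        change f x ≤ f _
        linarith
      · rw [Metric.mem_ball, dist_eq_norm] at hy ⊢
        rwa [show (2 : ℝ) • x - y - x = -(y - x) by module, norm_neg]
  have hbA : b ≤ 2 * μ A := by
    refine (measure_mono hcover).trans ((measure_union_le _ _).trans ?_)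
    rw [hrefl.measure_preimage hAm.nullMeasurableSet, two_mul]
  have hint : ENNReal.ofReal (Real.exp (f x - K)) * μ A ≤ B := by
    calc ENNReal.ofReal (Real.exp (f x - K)) * μ A
        = ∫⁻ _ in A, ENNReal.ofReal (Real.exp (f x - K)) ∂μ := by simp
      _ ≤ ∫⁻ y in A, ENNReal.ofReal (Real.exp (f y - u y)) ∂μ := by
          refine setLIntegral_mono' hAm fun y hy => ?_
          gcongr
          · exact hy.1
          · exact hK ⟨y, Metric.ball_subset_closedBall hy.2, rfl⟩
      _ ≤ ∫⁻ y, ENNReal.ofReal (Real.exp (f y - u y)) ∂μ := setLIntegral_le_lintegral _ _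
      _ ≤ B := hfB
  have hfin : ENNReal.ofReal (Real.exp (f x - K)) ≤ 2 * B / b := by
    rw [ENNReal.le_div_iff_mul_le (Or.inl hb0) (Or.inl hbt)]
    calc _ ≤ ENNReal.ofReal (Real.exp (f x - K)) * (2 * μ A) := by gcongr
      _ = 2 * (ENNReal.ofReal (Real.exp (f x - K)) * μ A) := by ring
      _ ≤ 2 * B := by gcongr
  have htop : 2 * B / b ≠ ⊤ := ENNReal.div_ne_top (ENNReal.mul_ne_top (by simp) hB) hb0
  have hexp : Real.exp (f x - K) ≤ (2 * B / b).toReal :=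
    (ENNReal.ofReal_le_iff_le_toReal htop).1 hfin
  have := (Real.le_log_iff_exp_le ((Real.exp_pos _).trans_le hexp)).2 hexp
  linarith

/-- Pointwise limits of convex functions along a filter are convex. -/
theorem ConvexOn.of_tendsto {E κ : Type} [AddCommGroup E] [Module ℝ E] {l : Filter κ} [l.NeBot]
    {g : κ → E → ℝ} {f : E → ℝ} (hg : ∀ i, ConvexOn ℝ Set.univ (g i))
    (h : ∀ x, Tendsto (fun i => g i x) l (𝓝 (f x))) : ConvexOn ℝ Set.univ f := by
  refine ⟨convex_univ, fun x _ y _ a b ha hb hab => ?_⟩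
  exact le_of_tendsto_of_tendsto' (h _) (((h x).const_smul a).add ((h y).const_smul b))
    fun i => (hg i).2 (Set.mem_univ x) (Set.mem_univ y) ha hb hab

section Limit

variable {E : Type} [NormedAddCommGroup E] [NormedSpace ℝ E] [FiniteDimensional ℝ E]

/-- A pointwise upper bound of convex functions is locally uniform. -/
theorem exists_forall_mem_ball_le {g : ℕ → E → ℝ} (hg : ∀ i, ConvexOn ℝ Set.univ (g i))
    (hb : ∀ x, ∃ C, ∀ i, g i x ≤ C) (x : E) : ∃ C, ∀ i, ∀ y ∈ Metric.ball x 1, g i y ≤ C := by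
  have : ProperSpace E := FiniteDimensional.proper ℝ E
  obtain ⟨u, hu, -⟩ := (convex_closedBall x 1).exists_subset_interior_convexHull_finset_of_isCompact
    (isCompact_closedBall x 1) (t := Set.univ) Filter.univ_mem
  choose C hC using hb
  obtain ⟨D, hD⟩ := (u.finite_toSet.image C).bddAbove
  refine ⟨D, fun i y hy => ?_⟩
  have hsub : convexHull ℝ (u : Set E) ⊆ {y ∈ Set.univ | g i y ≤ D} :=
    convexHull_min (fun z hz => ⟨Set.mem_univ _, (hC z i).trans (hD ⟨z, hz, rfl⟩)⟩)
      ((hg i).convex_le D)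
  exact (hsub (interior_subset (hu (Metric.ball_subset_closedBall hy)))).2

/-- Convergence of convex functions on a dense set controls the limit from above. -/
theorem ConvexOn.eventually_sub_le_of_dense {g : ℕ → E → ℝ}
    (hg : ∀ i, ConvexOn ℝ Set.univ (g i)) (hb : ∀ x, ∃ C, ∀ i, g i x ≤ C) {f : E → ℝ}
    (hf : Continuous f) {Q : Set E} (hQ : Dense Q)
    (hQf : ∀ q ∈ Q, Tendsto (fun i => g i q) atTop (𝓝 (f q))) (x : E) {δ : ℝ} (hδ : 0 < δ) :
    ∀ᶠ i in atTop, f x - δ ≤ g i x := by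
  obtain ⟨C, hC⟩ := exists_forall_mem_ball_le hg hb x
  set s : ℝ := min (1 / 2) (δ / (4 * (|C - f x + δ| + 1))) with hs
  have hs0 : 0 < s := by positivity
  have hs1 : s ≤ 1 / 2 := min_le_left _ _
  have hs2 : s * (C - f x + δ) ≤ δ / 4 := by
    calc s * (C - f x + δ) ≤ s * (|C - f x + δ| + 1) :=
          mul_le_mul_of_nonneg_left ((le_abs_self _).trans (by linarith)) hs0.le
      _ ≤ δ / (4 * (|C - f x + δ| + 1)) * (|C - f x + δ| + 1) :=
          mul_le_mul_of_nonneg_right (min_le_right _ _) (by positivity)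
      _ = δ / 4 := by field_simp
  obtain ⟨q, hq, hqx⟩ := hQ.exists_mem_open
    (Metric.isOpen_ball.inter (isOpen_Ioi.preimage hf) :
      IsOpen (Metric.ball x s ∩ f ⁻¹' Set.Ioi (f x - δ / 8))) ⟨x, by simp [hs0, hδ]⟩
  -- Here q lies between x and z. Since g i is at most C at z, a value at x below f x - δ would make
  -- g i at q too small once s is small.
  set z := x + s⁻¹ • (q - x) with hz
  have hzb : z ∈ Metric.ball x 1 := by
    rw [Metric.mem_ball, hz, dist_self_add_left, norm_smul, norm_inv, Real.norm_of_nonneg hs0.le,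
      inv_mul_lt_iff₀ hs0, mul_one, ← dist_eq_norm]
    exact hqx.1
  have hqz : (1 - s) • x + s • z = q := by
    rw [hz, smul_add, smul_inv_smul₀ hs0.ne']
    module
  filter_upwards [(hQf q hq).eventually (eventually_gt_nhds (sub_lt_self (f q) (by positivity : 0 < δ / 8)))] with i hi
  have h1 := (hg i).2 (Set.mem_univ x) (Set.mem_univ z) (show 0 ≤ 1 - s by linarith) hs0.le
    (by ring)
  rw [hqz] at h1
  simp only [smul_eq_mul] at h1
  have h2 := hC i z hzb
  have h3 : f x - δ / 8 < f q := hqx.2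
  by_contra! hlt
  have h4 := mul_le_mul_of_nonneg_left hlt.le (show 0 ≤ 1 - s by linarith)
  have h5 := mul_le_mul_of_nonneg_left h2 hs0.le
  linarith

end Limit

/-- Upper bounds for a sequence of jointly convex functions whose exponential integrals are
bounded on a dense set of times, propagated to every point. -/
theorem exists_forall_le_of_lintegral_exp_le_dense {m n : ℕ}
    {φ : EuclideanSpace ℝ (Fin m) × EuclideanSpace ℝ (Fin n) → ℝ} (hφ : ConvexOn ℝ Set.univ φ)
    {Ψ : ℕ → EuclideanSpace ℝ (Fin m) × EuclideanSpace ℝ (Fin n) → ℝ}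
    (hΨ : ∀ N, ConvexOn ℝ Set.univ (Ψ N)) {D : Set (EuclideanSpace ℝ (Fin m))} (hD : Dense D)
    {B : ENNReal} (hB : B ≠ ⊤)
    (hint : ∀ t ∈ D, ∀ᶠ N in atTop,
      ∫⁻ x, ENNReal.ofReal (Real.exp (Ψ N (t, x) - φ (t, x))) ≤ B)
    (q : EuclideanSpace ℝ (Fin m) × EuclideanSpace ℝ (Fin n)) : ∃ C, ∀ N, Ψ N q ≤ C := by
  set S : Set (EuclideanSpace ℝ (Fin m)) := {t | ∀ x, ∃ C, ∀ N, Ψ N (t, x) ≤ C} with hS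
  have hDS : D ⊆ S := by
    intro t ht x
    obtain ⟨C, hC⟩ := exists_forall_le_of_lintegral_exp_le volume (hφ.continuous_snd t) x hB
    have hb : IsBoundedUnder (· ≤ ·) atTop fun N => Ψ N (t, x) := by
      refine isBoundedUnder_of_eventually_le (a := C) ?_
      filter_upwards [hint t ht] with N hN
      refine hC (fun x => Ψ N (t, x)) ?_ hN
      refine ⟨convex_univ, fun x _ y _ a b ha hb hab => ?_⟩
      have := (hΨ N).2 (Set.mem_univ (t, x)) (Set.mem_univ (t, y)) ha hb hab
      simpa [← add_smul, hab] using this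
    obtain ⟨C', hC'⟩ := hb.bddAbove_range
    exact ⟨C', fun N => hC' ⟨N, rfl⟩⟩
  have hSc : Convex ℝ S := by
    intro s hs t ht a b ha hb hab x
    obtain ⟨C₁, h₁⟩ := hs x
    obtain ⟨C₂, h₂⟩ := ht x
    refine ⟨a * C₁ + b * C₂, fun N => ?_⟩
    have := (hΨ N).2 (Set.mem_univ (s, x)) (Set.mem_univ (t, x)) ha hb hab
    simp only [Prod.smul_mk, Prod.mk_add_mk, ← add_smul, hab, one_smul, smul_eq_mul] at this
    exact this.trans (add_le_add (mul_le_mul_of_nonneg_left (h₁ N) ha)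
      (mul_le_mul_of_nonneg_left (h₂ N) hb))
  have hSu := hSc.eq_univ_of_dense (hD.mono hDS)
  have : q.1 ∈ S := hSu ▸ Set.mem_univ _
  exact this q.2

theorem ConvexOn.continuous_of_finiteDimensional {E : Type} [NormedAddCommGroup E]
    [NormedSpace ℝ E] [FiniteDimensional ℝ E] {f : E → ℝ} (hf : ConvexOn ℝ Set.univ f) :
    Continuous f :=
  continuousOn_univ.1 (hf.continuousOn isOpen_univ)

/-- A pointwise bounded sequence of convex functions has a convex asymptotic lower bound along a
subsequence, to which it converges wherever the whole sequence converges. -/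
theorem exists_convexOn_subseq_limit {E : Type} [NormedAddCommGroup E] [NormedSpace ℝ E]
    [FiniteDimensional ℝ E] {g : ℕ → E → ℝ} (hg : ∀ i, ConvexOn ℝ Set.univ (g i))
    (hu : ∀ x, ∃ C, ∀ i, g i x ≤ C) (hl : ∀ x, ∃ C, ∀ i, C ≤ g i x) :
    ∃ f : E → ℝ, ConvexOn ℝ Set.univ f ∧ ∃ σ : ℕ → ℕ, StrictMono σ ∧
      (∀ x, ∀ δ > 0, ∀ᶠ i in atTop, f x - δ ≤ g (σ i) x) ∧
      ∀ x a, Tendsto (fun i => g i x) atTop (𝓝 a) → f x = a := by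
  choose U hU using hu
  choose V hV using hl
  set Q := TopologicalSpace.denseSeq E with hQ
  obtain ⟨y, -, σ, hσ, hy⟩ := (isCompact_univ_pi (s := fun k => Set.Icc (V (Q k)) (U (Q k)))
    fun k => isCompact_Icc).isSeqCompact (x := fun i k => g i (Q k))
    fun i k _ => ⟨hV _ _, hU _ _⟩
  -- The subsequence converges only on a countable dense set; an ultrafilter limit defines f
  -- everywhere, keeps convexity, and agrees with the true limit on that set.
  have hlim : ∀ x, ∃ a, Tendsto (fun i => g (σ i) x) (hyperfilter ℕ : Filter ℕ) (𝓝 a) := by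
    intro x
    obtain ⟨a, -, ha⟩ := (isCompact_Icc (a := V x) (b := U x)).ultrafilter_le_nhds
      ((hyperfilter ℕ).map fun i => g (σ i) x)
      (tendsto_principal.2 (Eventually.of_forall fun i => ⟨hV x _, hU x _⟩))
    exact ⟨a, ha⟩
  choose f hf using hlim
  have hfc : ConvexOn ℝ Set.univ f := ConvexOn.of_tendsto (fun i => hg (σ i)) hf
  refine ⟨f, hfc, σ, hσ, fun x δ hδ => ?_, fun x a ha => ?_⟩
  · refine ConvexOn.eventually_sub_le_of_dense (fun i => hg (σ i)) (fun x => ⟨U x, fun i => hU x _⟩)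
      hfc.continuous_of_finiteDimensional (TopologicalSpace.denseRange_denseSeq E) ?_ x hδ
    rintro _ ⟨k, rfl⟩
    have hk : Tendsto (fun i => g (σ i) (Q k)) atTop (𝓝 (y k)) := (tendsto_pi_nhds.1 hy) k
    rwa [tendsto_nhds_unique (hf (Q k)) (hk.mono_left Nat.hyperfilter_le_atTop)]
  · exact tendsto_nhds_unique (hf x)
      ((ha.comp hσ.tendsto_atTop).mono_left Nat.hyperfilter_le_atTop)

theorem exists_convexOn_extension_of_approx {m n : ℕ}
    {φ : EuclideanSpace ℝ (Fin m) × EuclideanSpace ℝ (Fin n) → ℝ} (hφ : ConvexOn ℝ Set.univ φ)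
    {ψ : EuclideanSpace ℝ (Fin n) → ℝ}
    {Ψ : ℕ → EuclideanSpace ℝ (Fin m) × EuclideanSpace ℝ (Fin n) → ℝ}
    (hΨ : ∀ N, ConvexOn ℝ Set.univ (Ψ N))
    (hlim : ∀ x, Tendsto (fun N => Ψ N (0, x)) atTop (𝓝 (ψ x)))
    {D : Set (EuclideanSpace ℝ (Fin m))} (hD : Dense D) {b : ℕ → ℝ}
    (hb : Tendsto b atTop (𝓝 1))
    (hint : ∀ t ∈ D, ∀ᶠ N in atTop,
      ∫⁻ x, ENNReal.ofReal (Real.exp (Ψ N (t, x) - φ (t, x))) ≤ ENNReal.ofReal (b N)) :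
    ∃ Φ : EuclideanSpace ℝ (Fin m) × EuclideanSpace ℝ (Fin n) → ℝ, ConvexOn ℝ Set.univ Φ ∧
      (∀ x, Φ (0, x) = ψ x) ∧
      ∀ t, ∫⁻ x, ENNReal.ofReal (Real.exp (Φ (t, x) - φ (t, x))) ≤ 1 := by
  have hup := exists_forall_le_of_lintegral_exp_le_dense hφ hΨ hD
    (ENNReal.ofReal_ne_top (r := 2)) fun t ht => by
      filter_upwards [hint t ht, hb.eventually_le_const (u := 2) (by norm_num)] with N h1 h2
      exact h1.trans (ENNReal.ofReal_le_ofReal h2)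
  have hlo : ∀ q, ∃ C, ∀ N, C ≤ Ψ N q := by
    rintro ⟨t, x⟩
    obtain ⟨U, hU⟩ := hup (-t, x)
    obtain ⟨V, hV⟩ := (hlim x).bddBelow_range
    -- Since (0, x) is the midpoint of (t, x) and (-t, x), a lower bound at time 0 and an upper
    -- bound at -t give a lower bound at t.
    refine ⟨2 * V - U, fun N => ?_⟩
    have h := (hΨ N).2 (Set.mem_univ (t, x)) (Set.mem_univ (-t, x))
      (show (0 : ℝ) ≤ 1 / 2 by norm_num) (show (0 : ℝ) ≤ 1 / 2 by norm_num) (by norm_num)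
    have e : (1 / 2 : ℝ) • (t, x) + (1 / 2 : ℝ) • (-t, x) = (0, x) := by
      ext1 <;> simp only [Prod.smul_mk, Prod.mk_add_mk] <;> module
    rw [e] at h
    simp only [smul_eq_mul] at h
    have h1 := hU N
    have h2 : V ≤ Ψ N (0, x) := hV ⟨N, rfl⟩
    linarith
  obtain ⟨Φ, hΦ, σ, hσ, hle, heq⟩ := exists_convexOn_subseq_limit hΨ hup hlo
  have hcont : ∀ N, Continuous (Ψ N) := fun N => (hΨ N).continuous_of_finiteDimensional
  have hφc := hφ.continuous_of_finiteDimensional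
  have hΦc := hΦ.continuous_of_finiteDimensional
  refine ⟨Φ, hΦ, fun x => heq _ _ (hlim x), ?_⟩
  have hDint : ∀ t ∈ D, ∫⁻ x, ENNReal.ofReal (Real.exp (Φ (t, x) - φ (t, x))) ≤ 1 := by
    intro t ht
    refine lintegral_exp_le_of_eventually (g := fun i x => Ψ (σ i) (t, x) - φ (t, x))
      (b := fun i => ENNReal.ofReal (b (σ i))) (fun i => ?_) (fun x δ hδ => ?_) ?_ ?_
    · have := hcont (σ i)
      exact Continuous.measurable (by fun_prop)
    · filter_upwards [hle (t, x) δ hδ] with i hi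
      linarith
    · simpa using ENNReal.tendsto_ofReal (hb.comp hσ.tendsto_atTop)
    · exact hσ.tendsto_atTop.eventually (hint t ht)
  -- A second use of Fatou, with continuity of Φ and φ, passes from the dense set of times to all
  -- times.
  intro t
  obtain ⟨s, hsD, hst⟩ := mem_closure_iff_seq_limit.1 (hD t)
  refine lintegral_exp_le_of_eventually (g := fun i x => Φ (s i, x) - φ (s i, x))
    (b := fun _ => 1) (fun i => Continuous.measurable (by fun_prop)) (fun x δ hδ => ?_)
    tendsto_const_nhds (Eventually.of_forall fun i => hDint _ (hsD i))
  have : Tendsto (fun i => Φ (s i, x) - φ (s i, x)) atTop (𝓝 (Φ (t, x) - φ (t, x))) :=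
    ((by fun_prop : Continuous fun t => Φ (t, x) - φ (t, x)).tendsto t).comp hst
  exact (this.eventually (eventually_gt_nhds (sub_lt_self _ hδ))).mono fun i hi => hi.le

/-! ### Approximation by log-sum-exp and conclusion -/

/-- A convex function on `ℝⁿ` is the limit of normalised logarithms of sums of exponentials of
affine functions that stay below it. -/
theorem exists_logSumExp_approx {n : ℕ} {ψ : EuclideanSpace ℝ (Fin n) → ℝ}
    (hψ : ConvexOn ℝ Set.univ ψ) :
    ∃ (θ : ℕ → ℝ) (ℓ : (N : ℕ) → Fin (N + 1) → EuclideanSpace ℝ (Fin n) →L[ℝ] ℝ)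
      (c : (N : ℕ) → Fin (N + 1) → ℝ), (∀ N, 0 < θ N) ∧ (∀ N, θ N ≤ 1) ∧
      (∀ N x, θ N * logSumExp (affineFamily (ℓ N) (c N) x) ≤ ψ x) ∧
      ∀ x, Tendsto (fun N => θ N * logSumExp (affineFamily (ℓ N) (c N) x)) atTop (𝓝 (ψ x)) := by
  obtain ⟨a, d, hle, hsup⟩ := ConvexOn.real_univ_sSup_of_nat_affine_eq
    hψ.continuous_of_finiteDimensional.lowerSemicontinuous hψ
  have hle' : ∀ i x, a i x + d i ≤ ψ x := fun i x => hle i x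
  -- Subtracting log(N + 1) compensates for the N + 1 summands, keeping the approximant below ψ;
  -- with k = (N + 1)² the loss log(N + 1)/k is at most 1/(N + 1).
  set k : ℕ → ℝ := fun N => ((N : ℝ) + 1) ^ 2 with hk
  have hk0 : ∀ N, 0 < k N := fun N => by positivity
  have hlog0 : ∀ N : ℕ, 0 ≤ Real.log ((N : ℝ) + 1) := fun N =>
    Real.log_nonneg (by simp)
  have haff : ∀ (N : ℕ) (x) (i : Fin (N + 1)),
      affineFamily (fun i : Fin (N + 1) => k N • a i)
        (fun i : Fin (N + 1) => k N * d i - Real.log ((N : ℝ) + 1)) x i =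
      k N * (a i x + d i) - Real.log ((N : ℝ) + 1) := fun N x i => by
    simp only [affineFamily, smul_apply, smul_eq_mul]
    ring
  have hup : ∀ (N : ℕ) x, (k N)⁻¹ * logSumExp (affineFamily (fun i : Fin (N + 1) => k N • a i)
      (fun i : Fin (N + 1) => k N * d i - Real.log ((N : ℝ) + 1)) x) ≤ ψ x := by
    intro N x
    rw [inv_mul_le_iff₀ (hk0 N), logSumExp_le_iff]
    calc _ ≤ ∑ _i : Fin (N + 1), Real.exp (k N * ψ x - Real.log ((N : ℝ) + 1)) := by
          refine Finset.sum_le_sum fun i _ => ?_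
          rw [haff]
          gcongr
          exact hle' i x
      _ = Real.exp (k N * ψ x) := by
          rw [Finset.sum_const, Finset.card_univ, Fintype.card_fin, nsmul_eq_mul, Real.exp_sub,
            Real.exp_log (by positivity)]
          push_cast
          field_simp
  refine ⟨fun N => (k N)⁻¹, fun N i => k N • a i, fun N i => k N * d i - Real.log ((N : ℝ) + 1),
    fun N => inv_pos.2 (hk0 N), fun N => inv_le_one_of_one_le₀ ?_, hup, fun x => ?_⟩
  · exact one_le_pow₀ (by simp)
  have hsupx : ⨆ i, (a i x + d i) = ψ x := by
    rw [← hsup, iSup_apply]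
    rfl
  refine tendsto_order.2 ⟨fun r hr => ?_, fun r hr => Eventually.of_forall fun N =>
    (hup N x).trans_lt hr⟩
  rw [← hsupx] at hr
  obtain ⟨i, hi⟩ := exists_lt_of_lt_ciSup hr
  have hz : Tendsto (fun N : ℕ => a i x + d i - 1 / ((N : ℝ) + 1)) atTop (𝓝 (a i x + d i)) := by
    simpa using tendsto_one_div_add_atTop_nhds_zero_nat.const_sub (a i x + d i)
  filter_upwards [hz.eventually (eventually_gt_nhds hi), eventually_ge_atTop i] with N h1 h2
  refine h1.trans_le ?_
  rw [le_inv_mul_iff₀ (hk0 N)]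
  refine le_trans ?_ (le_logSumExp _ (⟨i, Nat.lt_succ_of_le h2⟩ : Fin (N + 1)))
  rw [haff]
  have h3 : Real.log ((N : ℝ) + 1) ≤ (N : ℝ) + 1 := by
    linarith [Real.log_le_sub_one_of_pos (show (0 : ℝ) < (N : ℝ) + 1 by positivity)]
  have h4 : k N * (1 / ((N : ℝ) + 1)) = (N : ℝ) + 1 := by
    rw [hk]; field_simp
  rw [mul_sub, h4]
  dsimp only
  linarith

theorem theorem1p1 (m n : ℕ)
    (φ : EuclideanSpace ℝ (Fin m) × EuclideanSpace ℝ (Fin n) → ℝ)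
    (ψ : EuclideanSpace ℝ (Fin n) → ℝ)
    (hφ : ConvexOn ℝ Set.univ φ) (hψ : ConvexOn ℝ Set.univ ψ)
    (hint : ∫ x : EuclideanSpace ℝ (Fin n), Real.exp (ψ x - φ (0, x)) = 1) :
    ∃ Ψ : EuclideanSpace ℝ (Fin m) × EuclideanSpace ℝ (Fin n) → ℝ,
      ConvexOn ℝ Set.univ Ψ ∧
      (∀ x : EuclideanSpace ℝ (Fin n), Ψ (0, x) = ψ x) ∧
      ∀ t : EuclideanSpace ℝ (Fin m),
        Integrable (fun x : EuclideanSpace ℝ (Fin n) => Real.exp (Ψ (t, x) - φ (t, x))) ∧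
        ∫ x : EuclideanSpace ℝ (Fin n), Real.exp (Ψ (t, x) - φ (t, x)) ≤ 1 := by
  obtain ⟨θ, ℓ, c, hθ, hθ1, hle, hlim⟩ := exists_logSumExp_approx hψ
  -- The Bochner integral of a non-integrable function is 0, so the value 1 implies integrability.
  have hψi : Integrable fun x => Real.exp (ψ x - φ (0, x)) :=
    Integrable.of_integral_ne_zero (by rw [hint]; exact one_ne_zero)
  have h0 : ∀ N, Integrable fun x =>
      Real.exp (θ N * logSumExp (affineFamily (ℓ N) (c N) x) - φ (0, x)) := fun N => by
    have hc := continuous_lseIntegrand (continuous_affineFamily (ℓ N) (c N))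
      (hφ.continuous_snd 0) (θ N) 0
    simp only [add_zero] at hc
    refine hψi.mono hc.rexp.aestronglyMeasurable (Eventually.of_forall fun x => ?_)
    rw [Real.norm_of_nonneg (Real.exp_pos _).le, Real.norm_of_nonneg (Real.exp_pos _).le]
    gcongr
    exact hle N x
  have h1 : ∀ N, ∫ x, Real.exp
      (θ N * logSumExp (affineFamily (ℓ N) (c N) x) - φ (0, x)) ≤ 1 := fun N => by
    rw [← hint]
    refine integral_mono (h0 N) hψi fun x => ?_
    dsimp only
    gcongr
    exact hle N x
  set d := TopologicalSpace.denseSeq (EuclideanSpace ℝ (Fin m)) with hd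
  -- Stage N controls the first N + 1 points of a dense sequence of times with tolerance 1/(N + 1),
  -- so each of these times is eventually controlled.
  choose α hα using fun N : ℕ => exists_shiftMass_le hφ (hθ N) (hθ1 N) (ℓ N) (c N) (h0 N) (h1 N)
    ((Finset.range (N + 1)).image d) (Nat.one_div_pos_of_nat (n := N) (α := ℝ))
  obtain ⟨Ψ, hΨ, hΨ0, hΨi⟩ := exists_convexOn_extension_of_approx hφ (ψ := ψ)
    (Ψ := fun N p => θ N * logSumExp (affineFamily (ℓ N) (c N) p.2 + linearShift (α N) p.1))
    (fun N => (convexOn_logSumExp_shift (ℓ N) (c N) (α N)).smul (hθ N).le)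
    (fun x => by simpa using hlim x)
    (TopologicalSpace.denseRange_denseSeq (EuclideanSpace ℝ (Fin m)))
    (b := fun N : ℕ => 1 + 1 / ((N : ℝ) + 1))
    (by simpa using tendsto_one_div_add_atTop_nhds_zero_nat.const_add (1 : ℝ)) (by
      rintro _ ⟨j, rfl⟩
      filter_upwards [eventually_ge_atTop j] with N hN
      have hc := continuous_lseIntegrand (continuous_affineFamily (ℓ N) (c N))
        (hφ.continuous_snd (d j)) (θ N) (linearShift (α N) (d j))
      have hi := integrable_shiftMass hφ (hθ N) (hθ1 N) (ℓ N) (c N) (h0 N) (α N) (d j)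
      have hm := hα N (d j) (Finset.mem_image_of_mem d (Finset.mem_range.2 (by omega)))
      rw [shiftMass, lseMass, integral_exp_eq hc] at hm
      exact (ENNReal.le_ofReal_iff_toReal_le ((integrable_exp_iff hc).1 hi)
        (by positivity)).2 hm)
  refine ⟨Ψ, hΨ, hΨ0, fun t => ?_⟩
  have hc : Continuous fun x => Ψ (t, x) - φ (t, x) :=
    (hΨ.continuous_snd t).sub (hφ.continuous_snd t)
  refine ⟨(integrable_exp_iff hc).2 ((hΨi t).trans_lt ENNReal.one_lt_top).ne, ?_⟩
  rw [integral_exp_eq hc]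
  exact ENNReal.toReal_le_of_le_ofReal zero_le_one (by simpa using hΨi t)
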